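/- Consider the Gaussian wiretap channel with $M$ helpers $$Y_1=\sum_{i=1}^{M+1}h_iX_i+N_1,\qquad Y_2=\sum_{i=1}^{M+1}g_iX_i+N_2,$$ with gains $h_i\neq0$, $g_i\neq0$ for all $i$, and independent standard Gaussian noises $N_1,N_2$, i.i.d. over time. Boldface denotes $n$-letter vectors, $n\ge1$; logarithms are natural, $H$ is Shannon entropy and $h(\cdot)$ differential entropy. A code of length $n$, power $P$ and rate $R$ consists of a message $W$ uniform on a finite set $\mathcal W$ with $R=\frac1n\log|\mathcal W|$, an input $\mathbf X_1$ that is a stochastic function of $W$, helper inputs $\mathbf X_2,\dots,\mathbf X_{M+1}$, and a decoder $\hat W$ that is a function of $\mathbf Y_1$, where $(W,\mathbf X_1),\mathbf X_2,\dots,\mathbf X_{M+1},\mathbf N_1,\mathbf N_2$ are mutually independent and $\frac1n\sum_{t=1}^n\mathbb E[X_{i,t}^2]\le P$ for every $i$. It is $\epsilon$-reliable if $\Pr[W\ne\hat W]\le\epsilon$ and $\epsilon$-secure if $\frac1nH(W|\mathbf Y_2)\ge\frac1nH(W)-\epsilon$. Let $\tilde{\mathbf X}_i=\mathbf X_i+\tilde{\mathbf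 N}_i$, where $\tilde{\mathbf N}_i$ is i.i.d. in time, zero-mean Gaussian of variance $\tilde\sigma_i^2$ with $0<\tilde\sigma_i^2<\min(1/h_i^2,1/g_i^2)$, and the $\tilde{\mathbf N}_i$ are independent of each other and of all other random variables. For every $\kappa$ there are constants $c,c'$, depending only on $M$, the gains, the variances $\tilde\sigma_i^2$ and $\kappa$ (in particular not on $P$, $R$, $n$, $\epsilon$ or the code), such that for every code of any length $n\ge 1$, power $P$ and rate $R$ that is $\epsilon$-reliable and $\epsilon$-secure with $\epsilon(1+R)\le\kappa$, the differential entropies below are finite and $$nR\;\le\;\sum_{i=1}^{M+1}h(\tilde{\mathbf X}_i)-h(\mathbf Y_2)+nc\;\le\;\sum_{i=1,\,i\ne j}^{M+1}h(\tilde{\mathbf X}_i)+nc'\qquad\text{for every } j\in\{1,\dots,M+1\}.$$ (If $R$ is an achievable secrecy rate at power $P$, codes of rate $R$ with arbitrarily small $\epsilon$ exist, so with $\kappa=1$ the bound applies to all of them with $\epsilon\le 1/(1+R)$.) -/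

import Mathlib

open MeasureTheory ProbabilityTheory
open scoped NNReal ENNReal

/-- Differential entropy (in nats) `h = -∫ f log f` of a law on `ℝⁿ`, where `f` is its density with
respect to Lebesgue measure. Meaningful for laws satisfying `HasFiniteDiffEntropy`. -/
noncomputable def diffEntropy {n : ℕ} (ν : Measure (Fin n → ℝ)) : ℝ :=
  ∫ x, Real.negMulLog (ν.rnDeriv volume x).toReal

/-- The law has a density `f`, and `f log f` is Lebesgue integrable. -/
def HasFiniteDiffEntropy {n : ℕ} (ν : Measure (Fin n → ℝ)) : Prop :=
  ν ≪ volume ∧ Integrable (fun x => Real.negMulLog (ν.rnDeriv volume x).toReal) volume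

/-- Shannon entropy (in nats) of a random variable with values in a finite set. -/
noncomputable def shannonEntropy {Ω 𝓦 : Type*} [MeasurableSpace Ω] [Fintype 𝓦]
    (μ : Measure Ω) (W : Ω → 𝓦) : ℝ :=
  ∑ w, Real.negMulLog (μ.real (W ⁻¹' {w}))

/-- Conditional Shannon entropy `H(W | Y) = E[H(W | Y = y)]` of a random variable `W` with finitely
many values given an arbitrary random variable `Y`. -/
noncomputable def condShannonEntropy {Ω 𝓦 𝓨 : Type*} [MeasurableSpace Ω]
    [Fintype 𝓦] [Nonempty 𝓦] [MeasurableSpace 𝓦] [MeasurableSingletonClass 𝓦] [MeasurableSpace 𝓨]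
    (μ : Measure Ω) [IsFiniteMeasure μ] (W : Ω → 𝓦) (Y : Ω → 𝓨) : ℝ :=
  ∫ y, ∑ w, Real.negMulLog ((condDistrib W Y μ y).real {w}) ∂(μ.map Y)

/-- The mutually independent blocks of randomness in the wiretap channel with `M` helpers. -/
inductive WiretapBlock (M : ℕ) : Type
  | transmitter : WiretapBlock M
  | helper (i : Fin M) : WiretapBlock M
  | noiseReceiver : WiretapBlock M
  | noiseEavesdropper : WiretapBlock M
  | perturbation (i : Fin (M + 1)) : WiretapBlock M

/-- The sigma-algebra generated by each block. The legitimate transmitter has index `0`; its block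
consists of the message together with its channel input, so that the input may be an arbitrary
stochastic function of the message. Helper number `i` has index `i.succ`. -/
@[reducible] def wiretapSigma {Ω 𝓦 : Type*} [MeasurableSpace 𝓦] {M n : ℕ} (W : Ω → 𝓦)
    (X : Fin (M + 1) → Ω → Fin n → ℝ) (N₁ N₂ : Ω → Fin n → ℝ)
    (Nt : Fin (M + 1) → Ω → Fin n → ℝ) : WiretapBlock M → MeasurableSpace Ω
  | .transmitter => MeasurableSpace.comap (fun ω => (W ω, X 0 ω)) inferInstance
  | .helper i => MeasurableSpace.comap (X i.succ) inferInstance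
  | .noiseReceiver => MeasurableSpace.comap N₁ inferInstance
  | .noiseEavesdropper => MeasurableSpace.comap N₂ inferInstance
  | .perturbation i => MeasurableSpace.comap (Nt i) inferInstance

/-- Communication over `n` uses of the Gaussian wiretap channel with `M` helpers: a message uniform
on the finite set `𝓦`, the channel inputs (each an `n`-vector), the two channel noises, auxiliary
Gaussian perturbation noises of variances `v i`, and the decoder of the legitimate receiver. -/
structure WiretapScheme {Ω : Type*} [MeasurableSpace Ω] (μ : Measure Ω)
    (𝓦 : Type*) [Fintype 𝓦] [MeasurableSpace 𝓦] (M n : ℕ) (v : Fin (M + 1) → ℝ≥0) where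
  /-- the message -/
  W : Ω → 𝓦
  /-- the channel inputs; index `0` is the legitimate transmitter, the others are the helpers -/
  X : Fin (M + 1) → Ω → Fin n → ℝ
  /-- the noise at the legitimate receiver -/
  N₁ : Ω → Fin n → ℝ
  /-- the noise at the eavesdropper -/
  N₂ : Ω → Fin n → ℝ
  /-- the auxiliary perturbation noises -/
  Nt : Fin (M + 1) → Ω → Fin n → ℝ
  /-- the decoder of the legitimate receiver -/
  decoder : (Fin n → ℝ) → 𝓦
  measurable_W : Measurable W
  measurable_X : ∀ i, Measurable (X i)
  measurable_N₁ : Measurable N₁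
  measurable_N₂ : Measurable N₂
  measurable_Nt : ∀ i, Measurable (Nt i)
  measurable_decoder : Measurable decoder
  uniform_W : ∀ w, μ.real (W ⁻¹' {w}) = 1 / (Fintype.card 𝓦 : ℝ)
  law_N₁ : μ.map N₁ = Measure.pi (fun _ => gaussianReal 0 1)
  law_N₂ : μ.map N₂ = Measure.pi (fun _ => gaussianReal 0 1)
  law_Nt : ∀ i, μ.map (Nt i) = Measure.pi (fun _ => gaussianReal 0 (v i))
  indep : iIndep (wiretapSigma W X N₁ N₂ Nt) μ

namespace WiretapScheme

variable {Ω : Type*} [MeasurableSpace Ω] {μ : Measure Ω}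
  {𝓦 : Type*} [Fintype 𝓦] [MeasurableSpace 𝓦] {M n : ℕ} {v : Fin (M + 1) → ℝ≥0}

/-- The rate `R = (1/n) log |𝓦|`. -/
noncomputable def rate (_S : WiretapScheme μ 𝓦 M n v) : ℝ :=
  Real.log (Fintype.card 𝓦) / n

/-- The output at the legitimate receiver, `Y₁ = ∑ᵢ hᵢ Xᵢ + N₁`. -/
def Y₁ (S : WiretapScheme μ 𝓦 M n v) (h : Fin (M + 1) → ℝ) (ω : Ω) : Fin n → ℝ :=
  fun t => (∑ i, h i * S.X i ω t) + S.N₁ ω t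

/-- The output at the eavesdropper, `Y₂ = ∑ᵢ gᵢ Xᵢ + N₂`. -/
def Y₂ (S : WiretapScheme μ 𝓦 M n v) (g : Fin (M + 1) → ℝ) (ω : Ω) : Fin n → ℝ :=
  fun t => (∑ i, g i * S.X i ω t) + S.N₂ ω t

/-- The perturbed channel input. -/
def Xt (S : WiretapScheme μ 𝓦 M n v) (i : Fin (M + 1)) (ω : Ω) : Fin n → ℝ :=
  fun t => S.X i ω t + S.Nt i ω t

/-- Average power constraint: `(1/n) ∑ₜ E[X_{i,t}²] ≤ P` for each input. -/
def PowerConstraint (S : WiretapScheme μ 𝓦 M n v) (P : ℝ) : Prop :=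
  ∀ i, (∀ t, Integrable (fun ω => S.X i ω t ^ 2) μ) ∧
    (1 / (n : ℝ)) * (∑ t, ∫ ω, S.X i ω t ^ 2 ∂μ) ≤ P

/-- Reliability: the legitimate receiver errs with probability at most `ε`. -/
def Reliable (S : WiretapScheme μ 𝓦 M n v) (h : Fin (M + 1) → ℝ) (ε : ℝ) : Prop :=
  μ.real {ω | S.W ω ≠ S.decoder (S.Y₁ h ω)} ≤ ε

/-- Secrecy: `(1/n) H(W | Y₂) ≥ (1/n) H(W) - ε`. -/
def Secure [Nonempty 𝓦] [MeasurableSingletonClass 𝓦] [IsFiniteMeasure μ]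
    (S : WiretapScheme μ 𝓦 M n v) (g : Fin (M + 1) → ℝ) (ε : ℝ) : Prop :=
  (1 / (n : ℝ)) * shannonEntropy μ S.W - ε ≤ (1 / (n : ℝ)) * condShannonEntropy μ S.W (S.Y₂ g)

end WiretapScheme

/-!
Both inequalities are instances of one principle: if `L` is a random variable with `E[exp L] ≤ 1`,
then `E[L] ≤ 0` (`integral_nonpos_of_lintegral_exp_le_one`). No chain rule for conditional
differential entropies is needed.

*Upper bound on the rate.* Let `fᵢ` be the density of the perturbed input `X̃ᵢ`, let `f` be the
density of `Y₂`, and let `π_w(y) = P(W = w | Y₂ = y)`, so that `f π` is the joint density of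
`(Y₂, W)`. Simulate the channel by independent inputs with densities `fᵢ`, sent directly through
standard Gaussian noise, with a message guessed by the decoder from the simulated `Y₁` and
randomized so that no message is excluded. Its density (`simulationDensity`) is
`∏ fᵢ(x̃ᵢ) γ(y₂ - ∑ gᵢx̃ᵢ) γ(y₁ - ∑ hᵢx̃ᵢ) p(w | y₁)`, with `γ` the Gaussian density. Evaluate it at the true
`(X̃, Y₁, Y₂, W)`, and divide by `f(Y₂) π_W(Y₂)` and by the density of the noises `(N₁, Ñ)`. The
quotient has expectation at most one: given `(W, X, N₂)`, integrating out `(N₁, Ñ)` amounts, by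
translation invariance of Lebesgue measure, to integrating the simulated density over `(y₁, x̃)`,
which leaves the ratio of two densities of `(Y₂, W)` (`lintegral_density_ratio_le_one`). The
expectation of its logarithm is `-∑ h(X̃ᵢ) + h(Y₂) + H(W | Y₂)`, up to a constant per channel use
that comes from Gaussian second moments (`letterCost`), and up to `log 2 + P(error) log |𝓦|`
(`guessCost`), which plays the part of Fano's inequality. This gives
`WiretapScheme.condShannonEntropy_add_diffEntropy_le`; secrecy bounds `H(W | Y₂)` below by
`nR - nε`, and the terms with `ε` add up to at most `n ε (1 + R) ≤ n κ`.

*Comparison of `h(X̃ⱼ)` with `h(Y₂)`.* As `gⱼ² ṽⱼ < 1`, the noise `N₂` is distributed as `gⱼ Ñⱼ`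
plus an independent Gaussian. Hence `Y₂` is distributed as `gⱼ X̃ⱼ + B` with `B` independent of
`X̃ⱼ`, and adding `B` does not decrease the entropy: `h(X̃ⱼ) + n log |gⱼ| ≤ h(Y₂)`
(`diffEntropy_add_log_le`).

*Finiteness.* A vector with finite second moments plus an independent Gaussian vector has a density
between a multiple of a Gaussian density and a constant, so the logarithm of the density grows at
most quadratically (`hasFiniteDiffEntropy_conv_gaussian`).
-/

/-! ### Product measures with densities -/

theorem lintegral_fin_prod_eq_prod {n : ℕ} {E : Fin n → Type*} {mE : ∀ i, MeasurableSpace (E i)}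
    {μ : (i : Fin n) → Measure (E i)} [∀ i, SigmaFinite (μ i)]
    (f : (i : Fin n) → E i → ℝ≥0∞) (hf : ∀ i, Measurable (f i)) :
    ∫⁻ x, ∏ i, f i (x i) ∂(Measure.pi μ) = ∏ i, ∫⁻ x, f i x ∂(μ i) := by
  induction n with
  | zero => simp
  | succ n ih =>
    have hp := (measurePreserving_piFinSuccAbove μ 0).symm
    rw [← hp.lintegral_comp_emb (MeasurableEquiv.measurableEmbedding _), Fin.prod_univ_succ,
      ← ih _ fun i => hf i.succ, ← lintegral_prod_mul (hf 0).aemeasurable]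
    · refine lintegral_congr fun x => ?_
      rw [Fin.prod_univ_succ]
      rfl
    · exact (Finset.measurable_prod _ fun i _ => (hf _).comp (measurable_pi_apply i)).aemeasurable

theorem pi_withDensity {n : ℕ} {E : Fin n → Type*} {mE : ∀ i, MeasurableSpace (E i)}
    {μ : (i : Fin n) → Measure (E i)} [∀ i, SigmaFinite (μ i)]
    (f : (i : Fin n) → E i → ℝ≥0∞) (hf : ∀ i, Measurable (f i))
    [∀ i, SigmaFinite ((μ i).withDensity (f i))] :
    Measure.pi (fun i => (μ i).withDensity (f i)) =
      (Measure.pi μ).withDensity (fun x => ∏ i, f i (x i)) := by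
  refine Measure.pi_eq fun s hs => ?_
  rw [withDensity_apply _ (.univ_pi hs), ← lintegral_indicator (.univ_pi hs)]
  calc ∫⁻ x, (Set.univ.pi s).indicator (fun x => ∏ i, f i (x i)) x ∂(Measure.pi μ)
      = ∫⁻ x, ∏ i, (s i).indicator (f i) (x i) ∂(Measure.pi μ) := by
        refine lintegral_congr fun x => ?_
        by_cases hx : ∀ i, x i ∈ s i
        · rw [Set.indicator_of_mem (by simpa using hx)]
          exact Finset.prod_congr rfl fun i _ => (Set.indicator_of_mem (hx i) _).symm
        · rw [Set.indicator_of_notMem (by simpa using hx)]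
          push Not at hx
          obtain ⟨i, hi⟩ := hx
          exact (Finset.prod_eq_zero (Finset.mem_univ i) (Set.indicator_of_notMem hi _)).symm
    _ = _ := by
        rw [lintegral_fin_prod_eq_prod _ fun i => (hf i).indicator (hs i)]
        exact Finset.prod_congr rfl fun i _ => by
          rw [lintegral_indicator (hs i), withDensity_apply _ (hs i)]

/-! ### Gaussian vectors and convolutions -/

/-- The density of a vector of `n` independent centred Gaussian variables of variance `v`. -/
noncomputable def gaussianVecPDF (n : ℕ) (v : ℝ≥0) (x : Fin n → ℝ) : ℝ≥0∞ :=
  ∏ t, gaussianPDF 0 v (x t)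

@[fun_prop]
theorem measurable_gaussianVecPDF (n : ℕ) (v : ℝ≥0) : Measurable (gaussianVecPDF n v) :=
  Finset.measurable_prod _ fun t _ => (measurable_gaussianPDF 0 v).comp (measurable_pi_apply t)

theorem gaussianVecPDF_ne_zero {n : ℕ} {v : ℝ≥0} (hv : v ≠ 0) (x : Fin n → ℝ) :
    gaussianVecPDF n v x ≠ 0 :=
  Finset.prod_ne_zero_iff.2 fun _ _ => (gaussianPDF_pos 0 hv _).ne'

theorem gaussianVecPDF_ne_top {n : ℕ} {v : ℝ≥0} (x : Fin n → ℝ) :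
    gaussianVecPDF n v x ≠ ∞ :=
  ENNReal.prod_ne_top fun _ _ => gaussianPDF_ne_top

theorem lintegral_gaussianVecPDF (n : ℕ) {v : ℝ≥0} (hv : v ≠ 0) :
    ∫⁻ x, gaussianVecPDF n v x = 1 := by
  rw [volume_pi]
  unfold gaussianVecPDF
  rw [lintegral_fin_prod_eq_prod _ fun _ => measurable_gaussianPDF 0 v]
  simp [lintegral_gaussianPDF_eq_one 0 hv]

theorem pi_gaussianReal_eq_withDensity (n : ℕ) {v : ℝ≥0} (hv : v ≠ 0) :
    Measure.pi (fun _ : Fin n => gaussianReal 0 v) = volume.withDensity (gaussianVecPDF n v) := by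
  have hg : gaussianReal 0 v = volume.withDensity (gaussianPDF 0 v) :=
    gaussianReal_of_var_ne_zero 0 hv
  have : SigmaFinite ((volume : Measure ℝ).withDensity (gaussianPDF 0 v)) := by
    rw [← hg]; infer_instance
  rw [hg, pi_withDensity _ fun _ => measurable_gaussianPDF 0 v]
  rfl

theorem pi_conv_pi {n : ℕ} {E : Type*} [MeasurableSpace E] [AddMonoid E] [MeasurableAdd₂ E]
    (μ ν : Measure E) [IsProbabilityMeasure μ] [IsProbabilityMeasure ν] :
    (Measure.pi fun _ : Fin n => μ) ∗ (Measure.pi fun _ : Fin n => ν) =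
      Measure.pi fun _ : Fin n => μ ∗ ν := by
  have hm : Measurable fun p : E × E => p.1 + p.2 := by fun_prop
  unfold Measure.conv
  rw [← Measure.pi_map_pi fun _ => hm.aemeasurable,
    ← (measurePreserving_arrowProdEquivProdArrow E E (Fin n) (fun _ => μ) fun _ => ν).map_eq,
    Measure.map_map (by fun_prop) (by fun_prop)]
  rfl

/-! ### Log-densities and the entropy inequality -/

theorem lintegral_rnDeriv_eq_one {n : ℕ} {ν : Measure (Fin n → ℝ)} [IsProbabilityMeasure ν]
    (hν : ν ≪ volume) : ∫⁻ x, ν.rnDeriv volume x = 1 := by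
  rw [Measure.lintegral_rnDeriv hν, measure_univ]

section LogDensity

variable {Ω : Type*} [MeasurableSpace Ω] {μ : Measure Ω} [IsProbabilityMeasure μ] {n : ℕ}
  {ν : Measure (Fin n → ℝ)} {T : Ω → Fin n → ℝ}

theorem HasFiniteDiffEntropy.integrable_log (hν : HasFiniteDiffEntropy ν)
    (hT : MeasurePreserving T μ ν) :
    Integrable (fun ω => Real.log (ν.rnDeriv volume (T ω)).toReal) μ := by
  have : IsProbabilityMeasure ν := 
    hT.map_eq ▸ Measure.isProbabilityMeasure_map hT.aemeasurable
  refine hT.integrable_comp_of_integrable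
    (g := fun x => Real.log (ν.rnDeriv volume x).toReal) ?_
  rw [← integrable_rnDeriv_smul_iff hν.1]
  refine hν.2.neg.congr (.of_forall fun x => ?_)
  simp [Real.negMulLog]

theorem HasFiniteDiffEntropy.integral_log (hν : HasFiniteDiffEntropy ν)
    (hT : MeasurePreserving T μ ν) :
    ∫ ω, Real.log (ν.rnDeriv volume (T ω)).toReal ∂μ = -diffEntropy ν := by
  have : IsProbabilityMeasure ν := 
    hT.map_eq ▸ Measure.isProbabilityMeasure_map hT.aemeasurable
  have h1 : ∫ ω, Real.log (ν.rnDeriv volume (T ω)).toReal ∂μ =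
      ∫ x, Real.log (ν.rnDeriv volume x).toReal ∂ν := by
    conv_rhs => rw [← hT.map_eq]
    rw [integral_map hT.aemeasurable, hT.map_eq]
    exact (Real.measurable_log.comp
      (Measure.measurable_rnDeriv _ _).ennreal_toReal).aestronglyMeasurable
  rw [h1, ← integral_rnDeriv_smul hν.1, diffEntropy, ← integral_neg]
  refine integral_congr_ae (.of_forall fun x => ?_)
  simp [Real.negMulLog]

theorem HasFiniteDiffEntropy.ae_rnDeriv (hν : HasFiniteDiffEntropy ν)
    (hT : MeasurePreserving T μ ν) :
    ∀ᵐ ω ∂μ, ν.rnDeriv volume (T ω) ≠ 0 ∧ ν.rnDeriv volume (T ω) ≠ ∞ := by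
  have : IsProbabilityMeasure ν := 
    hT.map_eq ▸ Measure.isProbabilityMeasure_map hT.aemeasurable
  refine hT.quasiMeasurePreserving.ae
    (p := fun x => ν.rnDeriv volume x ≠ 0 ∧ ν.rnDeriv volume x ≠ ∞) ?_
  filter_upwards [Measure.rnDeriv_pos hν.1, hν.1.ae_le (Measure.rnDeriv_ne_top ν volume)]
    with x h1 h2 using ⟨h1.ne', h2⟩

end LogDensity

theorem ENNReal.ofReal_exp_log_toReal {x : ℝ≥0∞} (h0 : x ≠ 0) (h1 : x ≠ ∞) :
    ENNReal.ofReal (Real.exp (Real.log x.toReal)) = x := by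
  rw [Real.exp_log (ENNReal.toReal_pos h0 h1), ENNReal.ofReal_toReal h1]

theorem ENNReal.ofReal_exp_neg_log_toReal {x : ℝ≥0∞} (h0 : x ≠ 0) (h1 : x ≠ ∞) :
    ENNReal.ofReal (Real.exp (-Real.log x.toReal)) = x⁻¹ := by
  rw [Real.exp_neg, ENNReal.ofReal_inv_of_pos (Real.exp_pos _), ofReal_exp_log_toReal h0 h1]

/-- If `exp L` has expectation at most one, then `L` has expectation at most zero. This is the form
in which the non-negativity of relative entropy is used. -/
theorem integral_nonpos_of_lintegral_exp_le_one {Ω : Type*} [MeasurableSpace Ω] {μ : Measure Ω}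
    [IsProbabilityMeasure μ] {L : Ω → ℝ} (hL : Integrable L μ)
    (h : ∫⁻ ω, ENNReal.ofReal (Real.exp (L ω)) ∂μ ≤ 1) : ∫ ω, L ω ∂μ ≤ 0 := by
  have hm : AEStronglyMeasurable (fun ω => Real.exp (L ω)) μ :=
    Real.continuous_exp.comp_aestronglyMeasurable hL.1
  have hpos : 0 ≤ᵐ[μ] fun ω => Real.exp (L ω) := .of_forall fun ω => (Real.exp_pos _).le
  have hi : Integrable (fun ω => Real.exp (L ω)) μ :=
    (lintegral_ofReal_ne_top_iff_integrable hm hpos).1 (h.trans_lt ENNReal.one_lt_top).ne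
  have h1 : ∫ ω, Real.exp (L ω) ∂μ ≤ 1 := by
    rw [integral_eq_lintegral_of_nonneg_ae hpos hm]
    exact ENNReal.toReal_le_of_le_ofReal zero_le_one (by simpa using h)
  calc ∫ ω, L ω ∂μ ≤ ∫ ω, (Real.exp (L ω) - 1) ∂μ :=
        integral_mono hL (hi.sub (integrable_const 1)) fun ω => by
          have := Real.add_one_le_exp (L ω)
          simp only
          linarith
    _ = ∫ ω, Real.exp (L ω) ∂μ - 1 := by
        rw [integral_sub hi (integrable_const 1)]; simp
    _ ≤ 0 := by linarith

/-! ### Entropy of a sum of independent vectors -/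

/-- Adding an independent vector `B` does not decrease differential entropy, in the scaled form
`h(A) + n log |g| ≤ h(g A + B)`. Proved by taking the logarithm of
`|g|ⁿ f_{gA+B}(gA + B) / f_A(A)`, whose expectation is at most one. -/
theorem diffEntropy_add_log_le {n : ℕ} {ν ρ η : Measure (Fin n → ℝ)} [IsProbabilityMeasure ν]
    [IsProbabilityMeasure ρ] {g : ℝ} (hg : g ≠ 0)
    (hη : η = (ν.prod ρ).map fun p => g • p.1 + p.2)
    (hνf : HasFiniteDiffEntropy ν) (hηf : HasFiniteDiffEntropy η) :
    diffEntropy ν + n * Real.log |g| ≤ diffEntropy η := by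
  have hm : Measurable fun p : (Fin n → ℝ) × (Fin n → ℝ) => g • p.1 + p.2 := by fun_prop
  have : IsProbabilityMeasure η := hη ▸ Measure.isProbabilityMeasure_map hm.aemeasurable
  have hpη : MeasurePreserving (fun p : (Fin n → ℝ) × (Fin n → ℝ) => g • p.1 + p.2)
      (ν.prod ρ) η := ⟨hm, hη.symm⟩
  have hpν : MeasurePreserving (Prod.fst : (Fin n → ℝ) × (Fin n → ℝ) → _) (ν.prod ρ) ν :=
    measurePreserving_fst
  set fη := η.rnDeriv volume
  set fν := ν.rnDeriv volume
  have hmη : Measurable fη := Measure.measurable_rnDeriv _ _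
  have hmν : Measurable fν := Measure.measurable_rnDeriv _ _
  have iη := hηf.integrable_log hpη
  have iν := hνf.integrable_log hpν
  have eη := hηf.integral_log hpη
  have eν := hνf.integral_log hpν
  have key := integral_nonpos_of_lintegral_exp_le_one (μ := ν.prod ρ)
    (L := fun p => (Real.log (fη (g • p.1 + p.2)).toReal - Real.log (fν p.1).toReal)
      + n * Real.log |g|) ((iη.sub iν).add (integrable_const _)) ?_
  · have h1 := integral_add (iη.sub iν) (integrable_const (μ := ν.prod ρ) (n * Real.log |g|))
    have h2 := integral_sub iη iν
    simp only [Pi.sub_apply] at h1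
    rw [h1, h2, eη, eν] at key
    simp only [integral_const, probReal_univ, one_smul] at key
    linarith
  have pη := hηf.ae_rnDeriv hpη
  have pν := hνf.ae_rnDeriv hpν
  have hgpos : 0 < |g| ^ n := pow_pos (abs_pos.2 hg) n
  calc ∫⁻ p, ENNReal.ofReal (Real.exp ((Real.log (fη (g • p.1 + p.2)).toReal
          - Real.log (fν p.1).toReal) + n * Real.log |g|)) ∂(ν.prod ρ)
      = ∫⁻ p, (fν p.1)⁻¹ * (fη (g • p.1 + p.2) * ENNReal.ofReal (|g| ^ n)) ∂(ν.prod ρ) := by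
        refine lintegral_congr_ae ?_
        filter_upwards [pη, pν] with p h1 h2
        rw [Real.exp_add, sub_eq_add_neg, Real.exp_add, ENNReal.ofReal_mul (by positivity),
          ENNReal.ofReal_mul (by positivity), ENNReal.ofReal_exp_log_toReal h1.1 h1.2,
          ENNReal.ofReal_exp_neg_log_toReal h2.1 h2.2, ← Real.log_pow, Real.exp_log hgpos]
        ring
    _ = ∫⁻ b, ∫⁻ a, (fν a)⁻¹ * (fη (g • a + b) * ENNReal.ofReal (|g| ^ n)) ∂ν ∂ρ := by
        rw [lintegral_prod_symm]
        fun_prop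
    _ ≤ ∫⁻ _, 1 ∂ρ := by
        refine lintegral_mono fun b => ?_
        have hν' : ν = volume.withDensity fν := (Measure.withDensity_rnDeriv_eq _ _ hνf.1).symm
        calc ∫⁻ a, (fν a)⁻¹ * (fη (g • a + b) * ENNReal.ofReal (|g| ^ n)) ∂ν
            = ∫⁻ a, fν a * ((fν a)⁻¹ * (fη (g • a + b) * ENNReal.ofReal (|g| ^ n))) := by
              conv_lhs => rw [hν']
              rw [lintegral_withDensity_eq_lintegral_mul _ hmν (by fun_prop)]
              rfl
          _ ≤ ∫⁻ a, fη (g • a + b) * ENNReal.ofReal (|g| ^ n) := by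
              refine lintegral_mono fun a => ?_
              rw [← mul_assoc]
              exact mul_le_of_le_one_left' (ENNReal.mul_inv_le_one _)
          _ = (∫⁻ a, fη (a + b) ∂((volume : Measure (Fin n → ℝ)).map (g • ·)))
                * ENNReal.ofReal (|g| ^ n) := by
              rw [lintegral_mul_const _ (by fun_prop),
                lintegral_map (by fun_prop) (measurable_const_smul g)]
          _ = 1 := by
              rw [Measure.map_addHaar_smul _ hg, lintegral_smul_measure,
                lintegral_add_right_eq_self fη b, lintegral_rnDeriv_eq_one hηf.1, smul_eq_mul,
                mul_one, ← ENNReal.ofReal_mul (abs_nonneg _)]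
              simp [abs_inv, abs_pow, hgpos.ne']
    _ = 1 := by simp

/-! ### Finiteness of the entropy after Gaussian smoothing -/

/-- The density of `U + N`, for `U` of law `ρ` and an independent `N` with density `φ`. -/
theorem conv_withDensity {n : ℕ} (ρ : Measure (Fin n → ℝ)) [IsProbabilityMeasure ρ]
    {φ : (Fin n → ℝ) → ℝ≥0∞} (hφ : Measurable φ) :
    ρ ∗ volume.withDensity φ = volume.withDensity fun x => ∫⁻ u, φ (x - u) ∂ρ := by
  refine Measure.ext_of_lintegral _ fun F hF => ?_
  have hfd : Measurable fun x => ∫⁻ u, φ (x - u) ∂ρ :=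
    Measurable.lintegral_prod_right' (f := fun p : (Fin n → ℝ) × (Fin n → ℝ) => φ (p.1 - p.2))
      (by fun_prop)
  rw [Measure.lintegral_conv hF, lintegral_withDensity_eq_lintegral_mul _ hfd hF]
  calc ∫⁻ u, ∫⁻ z, F (u + z) ∂(volume.withDensity φ) ∂ρ
      = ∫⁻ u, ∫⁻ x, φ (x - u) * F x ∂volume ∂ρ := by
        refine lintegral_congr ?_
        intro u
        rw [lintegral_withDensity_eq_lintegral_mul _ hφ (by fun_prop),
          ← lintegral_add_left_eq_self (fun x => φ (x - u) * F x) u]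
        refine lintegral_congr fun z => ?_
        simp
    _ = _ := by
        rw [lintegral_lintegral_swap (by fun_prop)]
        refine lintegral_congr ?_
        intro x
        rw [lintegral_mul_const _ (by fun_prop)]
        rfl

theorem gaussianVecPDF_eq (n : ℕ) (v : ℝ≥0) (z : Fin n → ℝ) :
    gaussianVecPDF n v z = ENNReal.ofReal
      ((√(2 * Real.pi * v))⁻¹ ^ n * Real.exp (-(∑ t, z t ^ 2) / (2 * v))) := by
  unfold gaussianVecPDF gaussianPDF
  rw [← ENNReal.ofReal_prod_of_nonneg fun t _ => gaussianPDFReal_nonneg 0 v (z t)]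
  congr 1
  simp [gaussianPDFReal, Finset.prod_mul_distrib, ← Real.exp_sum, Finset.sum_div, neg_div]

theorem integrable_sq_pi_gaussianReal {n : ℕ} (v : ℝ≥0) (t : Fin n) :
    Integrable (fun z : Fin n → ℝ => z t ^ 2) (Measure.pi fun _ => gaussianReal 0 v) :=
  (measurePreserving_eval (fun _ : Fin n => gaussianReal 0 v) t).integrable_comp_of_integrable
    (g := fun x : ℝ => x ^ 2) (memLp_id_gaussianReal (μ := 0) (v := v) 2).integrable_sq

theorem integral_sq_pi_gaussianReal {n : ℕ} (v : ℝ≥0) (t : Fin n) :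
    ∫ z : Fin n → ℝ, z t ^ 2 ∂(Measure.pi fun _ => gaussianReal 0 v) = v := by
  rw [← variance_fun_id_gaussianReal (μ := 0) (v := v),
    variance_eq_integral measurable_id'.aemeasurable]
  conv_rhs =>
    rw [← (measurePreserving_eval (fun _ : Fin n => gaussianReal 0 v) t).map_eq]
  rw [integral_map (measurable_pi_apply t).aemeasurable (by fun_prop)]
  simp [(measurePreserving_eval (fun _ : Fin n => gaussianReal 0 v) t).map_eq]

/-- The law of `U + N`, with `U` of finite second moment and `N` an independent Gaussian vector,
has finite differential entropy: its density is bounded, and bounded below by a multiple of a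
Gaussian density, so that its logarithm is at most quadratic. -/
theorem hasFiniteDiffEntropy_conv_gaussian {n : ℕ} (ρ : Measure (Fin n → ℝ))
    [IsProbabilityMeasure ρ] (hρ : ∀ t, Integrable (fun u => u t ^ 2) ρ) {v : ℝ≥0} (hv : v ≠ 0) :
    HasFiniteDiffEntropy (ρ ∗ Measure.pi fun _ => gaussianReal 0 v) := by
  have hv0 : (0 : ℝ) < v := by exact_mod_cast pos_iff_ne_zero.2 hv
  have hφ := measurable_gaussianVecPDF n v
  set f : (Fin n → ℝ) → ℝ≥0∞ := fun x => ∫⁻ u, gaussianVecPDF n v (x - u) ∂ρ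
  have hfm : Measurable f :=
    Measurable.lintegral_prod_right'
      (f := fun p : (Fin n → ℝ) × (Fin n → ℝ) => gaussianVecPDF n v (p.1 - p.2)) (by fun_prop)
  set ν := ρ ∗ Measure.pi fun _ => gaussianReal 0 v with hνd
  have hν : ν = volume.withDensity f := by
    rw [hνd, pi_gaussianReal_eq_withDensity n hv, conv_withDensity ρ hφ]
  have hac : ν ≪ volume := hν ▸ withDensity_absolutelyContinuous _ _
  have hrn : ν.rnDeriv volume =ᵐ[ν] f :=
    hac.ae_le (hν ▸ Measure.rnDeriv_withDensity volume hfm)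
  -- second moments of `ν`
  have hsq : ∀ t, Integrable (fun x => x t ^ 2) ν := fun t => by
    have hmt : Measurable fun x : Fin n → ℝ => x t ^ 2 := (measurable_pi_apply t).pow_const 2
    rw [hνd, Measure.conv, integrable_map_measure hmt.aestronglyMeasurable (by fun_prop)]
    have h1 : MemLp (fun p : (Fin n → ℝ) × (Fin n → ℝ) => p.1 t) 2
        (ρ.prod (Measure.pi fun _ => gaussianReal 0 v)) :=
      (memLp_two_iff_integrable_sq (by fun_prop)).2 ((hρ t).comp_fst _)
    have h2 : MemLp (fun p : (Fin n → ℝ) × (Fin n → ℝ) => p.2 t) 2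
        (ρ.prod (Measure.pi fun _ => gaussianReal 0 v)) :=
      (memLp_two_iff_integrable_sq (by fun_prop)).2 ((integrable_sq_pi_gaussianReal v t).comp_snd _)
    exact (h1.add h2).integrable_sq
  -- the constants of the upper and lower bounds
  set K : ℝ := (√(2 * Real.pi * v))⁻¹ ^ n with hK
  have hK0 : 0 < K := by have := Real.pi_pos; positivity
  set e : (Fin n → ℝ) → ℝ := fun u => Real.exp (-(∑ t, u t ^ 2) / v)
  have hem : Measurable e := by fun_prop
  set I : ℝ≥0∞ := ∫⁻ u, ENNReal.ofReal (e u) ∂ρ with hI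
  have hI1 : I ≤ 1 := by
    calc I ≤ ∫⁻ _, 1 ∂ρ := lintegral_mono fun u => by
          refine ENNReal.ofReal_le_one.2 (Real.exp_le_one_iff.2 ?_)
          rw [neg_div, neg_nonpos]
          positivity
      _ = 1 := by simp
  have hI0 : I ≠ 0 := by
    rw [hI, Ne, lintegral_eq_zero_iff hem.ennreal_ofReal]
    intro h0
    obtain ⟨u, hu⟩ := h0.exists
    exact absurd hu (ENNReal.ofReal_pos.2 (Real.exp_pos _)).ne'
  have hItop : I ≠ ∞ := (hI1.trans_lt ENNReal.one_lt_top).ne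
  have hup : ∀ x, f x ≤ ENNReal.ofReal K := fun x => by
    calc f x ≤ ∫⁻ _, ENNReal.ofReal K ∂ρ := lintegral_mono fun u => by
          rw [gaussianVecPDF_eq]
          refine ENNReal.ofReal_le_ofReal (mul_le_of_le_one_right hK0.le
            (Real.exp_le_one_iff.2 ?_))
          rw [neg_div, neg_nonpos]
          positivity
      _ = _ := by simp
  have hlow : ∀ x, ENNReal.ofReal (K * e x) * I ≤ f x := fun x => by
    rw [hI, ← lintegral_const_mul _ hem.ennreal_ofReal]
    refine lintegral_mono fun u => ?_
    rw [gaussianVecPDF_eq, ← ENNReal.ofReal_mul (by positivity), mul_assoc, ← Real.exp_add]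
    refine ENNReal.ofReal_le_ofReal (mul_le_mul_of_nonneg_left (Real.exp_le_exp.2 ?_) hK0.le)
    have : ∑ t, (x - u) t ^ 2 ≤ 2 * (∑ t, x t ^ 2 + ∑ t, u t ^ 2) := by
      rw [← Finset.sum_add_distrib, Finset.mul_sum]
      refine Finset.sum_le_sum fun t _ => ?_
      simp only [Pi.sub_apply]
      nlinarith [sq_nonneg (x t + u t)]
    rw [← add_div, div_le_div_iff₀ hv0 (by positivity)]
    nlinarith
  have hlog : ∀ x, ‖Real.log (f x).toReal‖ ≤
      (|Real.log K| + |Real.log I.toReal|) + (∑ t, x t ^ 2) / v := fun x => by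
    have hItr : 0 < I.toReal := ENNReal.toReal_pos hI0 hItop
    have hft : f x ≠ ∞ := ((hup x).trans_lt ENNReal.ofReal_lt_top).ne
    have h1 : (f x).toReal ≤ K := ENNReal.toReal_le_of_le_ofReal hK0.le (hup x)
    have h2 : K * e x * I.toReal ≤ (f x).toReal := by
      have := ENNReal.toReal_mono hft (hlow x)
      rwa [ENNReal.toReal_mul, ENNReal.toReal_ofReal (by positivity)] at this
    have h3 : 0 < K * e x * I.toReal := by positivity
    have h4 := Real.log_le_log h3 h2
    have h5 := Real.log_le_log (h3.trans_le h2) h1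
    rw [Real.log_mul (by positivity) hItr.ne', Real.log_mul hK0.ne' (Real.exp_pos _).ne',
      Real.log_exp] at h4
    have h6 : 0 ≤ (∑ t, x t ^ 2) / (v : ℝ) := by positivity
    have h7 : -(∑ t, x t ^ 2) / (v : ℝ) = -((∑ t, x t ^ 2) / v) := neg_div _ _
    rw [Real.norm_eq_abs, abs_le]
    constructor
    · linarith [neg_abs_le (Real.log K), neg_abs_le (Real.log I.toReal)]
    · linarith [le_abs_self (Real.log K), abs_nonneg (Real.log I.toReal)]
  have hpν : IsProbabilityMeasure ν := by rw [hνd]; infer_instance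
  have hint : Integrable (fun x => Real.log (ν.rnDeriv volume x).toReal) ν := by
    have h1 : Integrable (fun x => Real.log (f x).toReal) ν := by
      refine Integrable.mono' ((integrable_const _).add
        ((integrable_finsetSum _ fun t _ => hsq t).div_const (v : ℝ)))
        (Real.measurable_log.comp hfm.ennreal_toReal).aestronglyMeasurable (.of_forall hlog)
    refine h1.congr ?_
    filter_upwards [hrn] with x hx
    rw [hx]
  refine ⟨hac, ((integrable_rnDeriv_smul_iff hac).2 hint).neg.congr (.of_forall fun x => ?_)⟩
  simp [Real.negMulLog]

/-! ### Change of variables in the noise -/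

/-- Let `(V, E)` be the pair of a variable `V = V(τ)` with density `f` and of a shift `E = s(τ) + N`
of a noise `N` with density `φ`, independent of `τ`. For any sub-probability density `K`, the ratio
`K(V, E) / (φ(N) f(V))` has expectation at most one. The variable `τ` itself needs no density. -/
theorem lintegral_density_ratio_le_one {Ω 𝒯 𝒱 E : Type*} [MeasurableSpace Ω] [MeasurableSpace 𝒯]
    [MeasurableSpace 𝒱] [MeasurableSpace E] [AddGroup E] [MeasurableAdd₂ E]
    {μ : Measure Ω} [IsProbabilityMeasure μ]
    {lam : Measure E} [SFinite lam] [lam.IsAddLeftInvariant] {base : Measure 𝒱}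
    {τ : Ω → 𝒯} {N : Ω → E} {s : 𝒯 → E} {V : 𝒯 → 𝒱} (hτ : Measurable τ) (hN : Measurable N)
    (hs : Measurable s) (hV : Measurable V) (hind : IndepFun τ N μ)
    {φ : E → ℝ≥0∞} (hφ : Measurable φ) (hNlaw : μ.map N = lam.withDensity φ)
    {f : 𝒱 → ℝ≥0∞} (hf : Measurable f)
    (hVlaw : μ.map (fun ω => V (τ ω)) = base.withDensity f)
    {K : 𝒱 → E → ℝ≥0∞} (hK : Measurable (Function.uncurry K))
    (hK1 : ∫⁻ x, ∫⁻ e, K x e ∂lam ∂base ≤ 1) :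
    ∫⁻ ω, K (V (τ ω)) (s (τ ω) + N ω) * ((φ (N ω))⁻¹ * (f (V (τ ω)))⁻¹) ∂μ ≤ 1 := by
  have hlaw : μ.map (fun ω => (τ ω, N ω)) = (μ.map τ).prod (lam.withDensity φ) := by
    rw [← hNlaw]
    exact (indepFun_iff_map_prod_eq_prod_map_map hτ.aemeasurable hN.aemeasurable).1 hind
  have hpτ : IsProbabilityMeasure (μ.map τ) := Measure.isProbabilityMeasure_map hτ.aemeasurable
  have hpN : IsProbabilityMeasure (lam.withDensity φ) :=
    hNlaw ▸ Measure.isProbabilityMeasure_map hN.aemeasurable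
  have hq : Measurable fun x => ∫⁻ e, K x e ∂lam := hK.lintegral_prod_right'
  have hfq : Measurable fun x => (f x)⁻¹ * ∫⁻ e, K x e ∂lam := hf.inv.mul hq
  have hVτ : Measurable fun ω => V (τ ω) := hV.comp hτ
  have hm : Measurable fun p : 𝒯 × E =>
      K (V p.1) (s p.1 + p.2) * ((φ p.2)⁻¹ * (f (V p.1))⁻¹) :=
    (hK.comp ((hV.comp measurable_fst).prodMk
      ((hs.comp measurable_fst).add measurable_snd))).mul (by fun_prop)
  calc ∫⁻ ω, K (V (τ ω)) (s (τ ω) + N ω) * ((φ (N ω))⁻¹ * (f (V (τ ω)))⁻¹) ∂μ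
      = ∫⁻ p, K (V p.1) (s p.1 + p.2) * ((φ p.2)⁻¹ * (f (V p.1))⁻¹)
          ∂((μ.map τ).prod (lam.withDensity φ)) := by
        rw [← hlaw, lintegral_map hm (hτ.prodMk hN)]
    _ = ∫⁻ t, ∫⁻ e, K (V t) (s t + e) * ((φ e)⁻¹ * (f (V t))⁻¹) ∂(lam.withDensity φ)
          ∂(μ.map τ) := lintegral_prod _ hm.aemeasurable
    _ ≤ ∫⁻ t, (f (V t))⁻¹ * ∫⁻ e, K (V t) e ∂lam ∂(μ.map τ) := by
        refine lintegral_mono fun t => ?_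
        have hKt : Measurable fun e => K (V t) (s t + e) :=
          hK.comp (measurable_const.prodMk (measurable_const.add measurable_id))
        calc ∫⁻ e, K (V t) (s t + e) * ((φ e)⁻¹ * (f (V t))⁻¹) ∂(lam.withDensity φ)
            = ∫⁻ e, φ e * (K (V t) (s t + e) * ((φ e)⁻¹ * (f (V t))⁻¹)) ∂lam :=
              lintegral_withDensity_eq_lintegral_mul _ hφ
                (hKt.mul (hφ.inv.mul measurable_const))
          _ ≤ ∫⁻ e, (f (V t))⁻¹ * K (V t) (s t + e) ∂lam := by
              refine lintegral_mono fun e => ?_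
              calc φ e * (K (V t) (s t + e) * ((φ e)⁻¹ * (f (V t))⁻¹))
                  = (φ e * (φ e)⁻¹) * ((f (V t))⁻¹ * K (V t) (s t + e)) := by ring
                _ ≤ _ := mul_le_of_le_one_left' (ENNReal.mul_inv_le_one _)
          _ = _ := by
              rw [lintegral_const_mul _ hKt, lintegral_add_left_eq_self (K (V t)) (s t)]
    _ = ∫⁻ x, (f x)⁻¹ * ∫⁻ e, K x e ∂lam ∂(base.withDensity f) := by
        rw [← hVlaw, lintegral_map hfq hVτ]
        exact lintegral_map (hfq.comp hV) hτ
    _ = ∫⁻ x, f x * ((f x)⁻¹ * ∫⁻ e, K x e ∂lam) ∂base :=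
        lintegral_withDensity_eq_lintegral_mul _ hf (hf.inv.mul hq)
    _ ≤ ∫⁻ x, ∫⁻ e, K x e ∂lam ∂base := by
        refine lintegral_mono fun x => ?_
        rw [← mul_assoc]
        exact mul_le_of_le_one_left' (ENNReal.mul_inv_le_one _)
    _ ≤ 1 := hK1

/-! ### Posterior law of the message -/

section Posterior

variable {Ω 𝓦 : Type*} [MeasurableSpace Ω] {μ : Measure Ω} [IsProbabilityMeasure μ]
  [Fintype 𝓦] [Nonempty 𝓦] [MeasurableSpace 𝓦] [MeasurableSingletonClass 𝓦]
  {n : ℕ} {W : Ω → 𝓦} {Y : Ω → Fin n → ℝ}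

theorem measurable_condDistrib_singleton :
    Measurable fun p : (Fin n → ℝ) × 𝓦 => condDistrib W Y μ p.1 {p.2} :=
  measurable_from_prod_countable_left fun w =>
    (condDistrib W Y μ).measurable_coe (measurableSet_singleton w)

/-- The joint law of `Y` and the discrete `W` has density `f_Y(y) P(W = w | Y = y)`. -/
theorem map_prod_eq_withDensity (hW : Measurable W)
    (hYac : μ.map Y ≪ volume) :
    μ.map (fun ω => (Y ω, W ω)) = ((volume : Measure (Fin n → ℝ)).prod Measure.count).withDensity
      (fun p => (μ.map Y).rnDeriv volume p.1 * condDistrib W Y μ p.1 {p.2}) := by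
  have hc := measurable_condDistrib_singleton (μ := μ) (W := W) (Y := Y)
  have hr := Measure.measurable_rnDeriv (μ.map Y) volume
  have hfm : Measurable fun p : (Fin n → ℝ) × 𝓦 =>
      (μ.map Y).rnDeriv volume p.1 * condDistrib W Y μ p.1 {p.2} :=
    (hr.comp measurable_fst).mul hc
  rw [← compProd_map_condDistrib hW.aemeasurable]
  refine Measure.ext_of_lintegral _ fun F hF => ?_
  rw [Measure.lintegral_compProd hF, lintegral_withDensity_eq_lintegral_mul _
    hfm hF, lintegral_prod _
    (hfm.mul hF).aemeasurable]
  conv_lhs => rw [← Measure.withDensity_rnDeriv_eq _ _ hYac]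
  have hm : Measurable fun y => ∫⁻ w, F (y, w) ∂(condDistrib W Y μ y) :=
    hF.lintegral_kernel_prod_right'
  rw [lintegral_withDensity_eq_lintegral_mul _ hr hm]
  refine lintegral_congr fun y => ?_
  simp only [Pi.mul_apply, lintegral_fintype, Measure.count_singleton, mul_one]
  rw [Finset.mul_sum]
  exact Finset.sum_congr rfl fun w _ => by ring

/-- `H(W | Y)` is the expectation of `-log P(W = w | Y = y)` at the true `(W, Y)`. -/
theorem integrable_integral_log_condDistrib (hW : Measurable W) (hY : Measurable Y) :
    Integrable (fun ω => Real.log (condDistrib W Y μ (Y ω) {W ω}).toReal) μ ∧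
    ∫ ω, Real.log (condDistrib W Y μ (Y ω) {W ω}).toReal ∂μ = -condShannonEntropy μ W Y := by
  set κ := condDistrib W Y μ
  have hp : MeasurePreserving (fun ω => (Y ω, W ω)) μ ((μ.map Y) ⊗ₘ κ) :=
    ⟨hY.prodMk hW, (compProd_map_condDistrib hW.aemeasurable).symm⟩
  have hpY : IsProbabilityMeasure (μ.map Y) := Measure.isProbabilityMeasure_map hY.aemeasurable
  set G : (Fin n → ℝ) × 𝓦 → ℝ := fun p => Real.log (κ p.1 {p.2}).toReal
  have hG : Measurable G :=
    Real.measurable_log.comp measurable_condDistrib_singleton.ennreal_toReal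
  have h01 : ∀ y w, 0 ≤ (κ y).real {w} ∧ (κ y).real {w} ≤ 1 :=
    fun y w => ⟨measureReal_nonneg, measureReal_le_one⟩
  have hm : ∀ w, Measurable fun y => (κ y).real {w} := fun w =>
    (κ.measurable_coe (measurableSet_singleton w)).ennreal_toReal
  have hGi : Integrable G ((μ.map Y) ⊗ₘ κ) := by
    rw [Measure.integrable_compProd_iff hG.aestronglyMeasurable]
    refine ⟨.of_forall fun y => .of_finite, ?_⟩
    have heq : (fun y => ∫ w, ‖G (y, w)‖ ∂(κ y)) =
        fun y => ∑ w, Real.negMulLog ((κ y).real {w}) := by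
      funext y
      rw [integral_fintype .of_finite]
      refine Finset.sum_congr rfl fun w _ => ?_
      have hGw : G (y, w) = Real.log ((κ y).real {w}) := rfl
      rw [hGw, Real.norm_of_nonpos (Real.log_nonpos (h01 y w).1 (h01 y w).2), Real.negMulLog]
      simp only [smul_eq_mul]
      ring
    rw [heq]
    refine integrable_finsetSum _ fun w _ => ?_
    refine Integrable.mono' (integrable_const (1 : ℝ))
      (Real.continuous_negMulLog.measurable.comp (hm w)).aestronglyMeasurable
      (.of_forall fun y => ?_)
    rw [Real.norm_of_nonneg (Real.negMulLog_nonneg (h01 y w).1 (h01 y w).2)]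
    have := Real.negMulLog_le_one_sub_self (h01 y w).1
    linarith [(h01 y w).1]
  refine ⟨hp.integrable_comp_of_integrable hGi, ?_⟩
  have h1 : ∫ ω, G (Y ω, W ω) ∂μ = ∫ p, G p ∂((μ.map Y) ⊗ₘ κ) := by
    conv_rhs => rw [← hp.map_eq]
    rw [integral_map hp.aemeasurable hG.aestronglyMeasurable]
  change ∫ ω, G (Y ω, W ω) ∂μ = _
  rw [h1, Measure.integral_compProd hGi, condShannonEntropy, ← integral_neg]
  refine integral_congr_ae (.of_forall fun y => ?_)
  simp only
  rw [integral_fintype .of_finite, ← Finset.sum_neg_distrib]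
  refine Finset.sum_congr rfl fun w _ => ?_
  simp [G, Real.negMulLog, Measure.real, κ]

end Posterior

/-! ### Log-likelihood cost of the Gaussian noises -/

section LetterBound

variable {M : ℕ} (h g : Fin (M + 1) → ℝ) (v : Fin (M + 1) → ℝ≥0)

/-- Quadratic upper bound on the log-likelihood cost of one channel use, as a function of the
noises `a`, `b` at the two receivers and of the perturbations `z`. -/
noncomputable def letterCost (a b : ℝ) (z : Fin (M + 1) → ℝ) : ℝ :=
  Real.log √(2 * Real.pi) - ∑ i, Real.log √(2 * Real.pi * v i)
    + (a ^ 2 + b ^ 2 + (∑ i, h i ^ 2 + ∑ i, g i ^ 2) * ∑ i, z i ^ 2)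

/-- The expectation of `letterCost`. -/
noncomputable def meanLetterCost : ℝ :=
  Real.log √(2 * Real.pi) - ∑ i, Real.log √(2 * Real.pi * v i)
    + (1 + 1 + (∑ i, h i ^ 2 + ∑ i, g i ^ 2) * ∑ i, (v i : ℝ))

theorem gaussianPDFReal_eq_exp {v : ℝ≥0} (hv : 0 < v) (x : ℝ) :
    gaussianPDFReal 0 v x = Real.exp (-Real.log √(2 * Real.pi * v) - x ^ 2 / (2 * v)) := by
  have : (0 : ℝ) < √(2 * Real.pi * v) := by
    have := Real.pi_pos
    have : (0 : ℝ) < v := hv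
    positivity
  rw [Real.exp_sub, Real.exp_neg, Real.exp_log this, gaussianPDFReal, sub_zero, neg_div,
    Real.exp_neg, ← div_eq_mul_inv]

/-- The arguments on the right are what remains of the channel outputs after subtracting the
contributions of the perturbed inputs. -/
theorem exp_neg_letterCost_mul_le (hv : ∀ i, 0 < v i) (a b : ℝ) (z : Fin (M + 1) → ℝ) :
    Real.exp (-letterCost h g v a b z) *
        (gaussianPDFReal 0 1 a * ∏ i, gaussianPDFReal 0 (v i) (z i)) ≤
      gaussianPDFReal 0 1 (b - ∑ i, g i * z i) * gaussianPDFReal 0 1 (a - ∑ i, h i * z i) := by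
  simp only [gaussianPDFReal_eq_exp one_pos, gaussianPDFReal_eq_exp (hv _), ← Real.exp_sum,
    ← Real.exp_add]
  refine Real.exp_le_exp.2 ?_
  have hcs : ∀ (k : Fin (M + 1) → ℝ) (c : ℝ),
      (c - ∑ i, k i * z i) ^ 2 / 2 ≤ c ^ 2 + (∑ i, k i ^ 2) * ∑ i, z i ^ 2 := fun k c => by
    have := Finset.sum_mul_sq_le_sq_mul_sq Finset.univ k z
    nlinarith [sq_nonneg (c + ∑ i, k i * z i)]
  have h1 := hcs g b
  have h2 := hcs h a
  have h3 : 0 ≤ ∑ i, z i ^ 2 / (2 * (v i : ℝ)) :=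
    Finset.sum_nonneg fun i _ => by positivity
  simp only [letterCost, Finset.sum_sub_distrib, Finset.sum_neg_distrib, NNReal.coe_one, mul_one]
  nlinarith [sq_nonneg a]

theorem ofReal_exp_neg_sum_letterCost_mul_le (hv : ∀ i, 0 < v i) {n : ℕ} (a b : Fin n → ℝ)
    (z : Fin (M + 1) → Fin n → ℝ) :
    ENNReal.ofReal (Real.exp (-∑ t, letterCost h g v (a t) (b t) fun i => z i t)) *
        (gaussianVecPDF n 1 a * ∏ i, gaussianVecPDF n (v i) (z i)) ≤
      gaussianVecPDF n 1 (fun t => b t - ∑ i, g i * z i t) *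
        gaussianVecPDF n 1 (fun t => a t - ∑ i, h i * z i t) := by
  unfold gaussianVecPDF
  rw [Finset.prod_comm, ← Finset.sum_neg_distrib, Real.exp_sum,
    ENNReal.ofReal_prod_of_nonneg fun _ _ => (Real.exp_pos _).le, ← Finset.prod_mul_distrib,
    ← Finset.prod_mul_distrib, ← Finset.prod_mul_distrib]
  refine Finset.prod_le_prod' fun t _ => ?_
  have hnn := fun (v : ℝ≥0) (x : ℝ) => gaussianPDFReal_nonneg 0 v x
  unfold gaussianPDF
  rw [← ENNReal.ofReal_prod_of_nonneg fun i _ => hnn (v i) (z i t), ← ENNReal.ofReal_mul (hnn _ _),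
    ← ENNReal.ofReal_mul (Real.exp_pos _).le, ← ENNReal.ofReal_mul (hnn _ _)]
  exact ENNReal.ofReal_le_ofReal (exp_neg_letterCost_mul_le h g v hv _ _ _)

end LetterBound

/-! ### Independence of the blocks of a scheme -/

namespace WiretapScheme

variable {Ω : Type*} [MeasurableSpace Ω] {μ : Measure Ω}
  {𝓦 : Type*} [Fintype 𝓦] [MeasurableSpace 𝓦] {M n : ℕ} {v : Fin (M + 1) → ℝ≥0}

/-- The block of randomness that generates the input with index `i`. -/
def inputBlock (i : Fin (M + 1)) : WiretapBlock M :=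
  Fin.cases .transmitter .helper i

theorem inputBlock_injective : Function.Injective (inputBlock (M := M)) := by
  intro i j hij
  induction i using Fin.cases <;> induction j using Fin.cases <;>
    simp_all [inputBlock]

theorem inputBlock_ne_noiseEavesdropper (i : Fin (M + 1)) :
    inputBlock i ≠ .noiseEavesdropper := by
  induction i using Fin.cases <;> simp [inputBlock]

theorem inputBlock_ne_noiseReceiver (i : Fin (M + 1)) :
    inputBlock i ≠ .noiseReceiver := by
  induction i using Fin.cases <;> simp [inputBlock]

theorem inputBlock_ne_perturbation (i j : Fin (M + 1)) :
    inputBlock i ≠ .perturbation j := by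
  induction i using Fin.cases <;> simp [inputBlock]

/-- The sigma-algebra generated by a set of blocks. -/
@[reducible] def blockSigma (S : WiretapScheme μ 𝓦 M n v) (A : Set (WiretapBlock M)) :
    MeasurableSpace Ω :=
  ⨆ b ∈ A, wiretapSigma S.W S.X S.N₁ S.N₂ S.Nt b

variable (S : WiretapScheme μ 𝓦 M n v) {A B : Set (WiretapBlock M)}

theorem measurable_blockSigma {β : Type*} [MeasurableSpace β] {f : Ω → β} (b : WiretapBlock M)
    (hb : b ∈ A) (hf : Measurable[wiretapSigma S.W S.X S.N₁ S.N₂ S.Nt b] f) :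
    Measurable[S.blockSigma A] f :=
  hf.mono (le_iSup₂_of_le b hb le_rfl) le_rfl

theorem measurable_blockSigma_W (hb : .transmitter ∈ A) : Measurable[S.blockSigma A] S.W :=
  S.measurable_blockSigma _ hb (measurable_fst.comp (comap_measurable _))

theorem measurable_blockSigma_X (i : Fin (M + 1)) (hb : inputBlock i ∈ A) :
    Measurable[S.blockSigma A] (S.X i) := by
  refine S.measurable_blockSigma _ hb ?_
  induction i using Fin.cases with
  | zero => exact measurable_snd.comp (comap_measurable fun ω => (S.W ω, S.X 0 ω))
  | succ i => exact comap_measurable _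

theorem measurable_blockSigma_N₁ (hb : .noiseReceiver ∈ A) :
    Measurable[S.blockSigma A] S.N₁ :=
  S.measurable_blockSigma _ hb (comap_measurable _)

theorem measurable_blockSigma_N₂ (hb : .noiseEavesdropper ∈ A) :
    Measurable[S.blockSigma A] S.N₂ :=
  S.measurable_blockSigma _ hb (comap_measurable _)

theorem measurable_blockSigma_Nt (i : Fin (M + 1)) (hb : .perturbation i ∈ A) :
    Measurable[S.blockSigma A] (S.Nt i) :=
  S.measurable_blockSigma _ hb (comap_measurable _)

theorem wiretapSigma_le (b : WiretapBlock M) :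
    wiretapSigma S.W S.X S.N₁ S.N₂ S.Nt b ≤ ‹MeasurableSpace Ω› := by
  cases b with
  | transmitter => exact (S.measurable_W.prodMk (S.measurable_X 0)).comap_le
  | helper i => exact (S.measurable_X _).comap_le
  | noiseReceiver => exact S.measurable_N₁.comap_le
  | noiseEavesdropper => exact S.measurable_N₂.comap_le
  | perturbation i => exact (S.measurable_Nt i).comap_le

/-- Functions of disjoint sets of blocks are independent. -/
theorem indepFun_of_disjoint {β γ : Type*} [MeasurableSpace β] [MeasurableSpace γ]
    {f : Ω → β} {k : Ω → γ} (hAB : Disjoint A B)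
    (hf : Measurable[S.blockSigma A] f) (hk : Measurable[S.blockSigma B] k) :
    IndepFun f k μ := by
  rw [IndepFun_iff_Indep]
  exact indep_of_indep_of_le_left (indep_of_indep_of_le_right
    (indep_iSup_of_disjoint S.wiretapSigma_le S.indep hAB) hk.comap_le) hf.comap_le

theorem indepFun_X_Nt (i : Fin (M + 1)) : IndepFun (S.X i) (S.Nt i) μ :=
  S.indepFun_of_disjoint (A := {inputBlock i}) (B := {.perturbation i})
    (by simpa using inputBlock_ne_perturbation i i)
    (S.measurable_blockSigma_X i rfl) (S.measurable_blockSigma_Nt i rfl)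

theorem indepFun_code_noise :
    IndepFun (fun ω => ((S.W ω, fun i => S.X i ω), S.N₂ ω))
      (fun ω => (S.N₁ ω, fun i => S.Nt i ω)) μ := by
  refine S.indepFun_of_disjoint
    (A := insert .noiseEavesdropper (Set.range inputBlock))
    (B := insert .noiseReceiver (Set.range .perturbation)) ?_ ?_ ?_
  · rw [Set.disjoint_left]
    rintro b (rfl | ⟨i, rfl⟩) (hb | ⟨j, hb⟩)
    · cases hb
    · cases hb
    · exact inputBlock_ne_noiseReceiver i hb
    · exact inputBlock_ne_perturbation i j hb.symm
  · refine Measurable.prodMk (Measurable.prodMk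
      (S.measurable_blockSigma_W (.inr ⟨0, rfl⟩)) ?_) (S.measurable_blockSigma_N₂ (.inl rfl))
    exact @measurable_pi_lambda _ _ _ (S.blockSigma _) _ _
      fun i => S.measurable_blockSigma_X i (.inr ⟨i, rfl⟩)
  · refine Measurable.prodMk (S.measurable_blockSigma_N₁ (.inl rfl)) ?_
    exact @measurable_pi_lambda _ _ _ (S.blockSigma _) _ _
      fun i => S.measurable_blockSigma_Nt i (.inr ⟨i, rfl⟩)

/-! ### Laws and entropies of the perturbed inputs and of the eavesdropper's output -/

/-- The contribution to `Y₂` of all inputs but one. -/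
def interference (S : WiretapScheme μ 𝓦 M n v) (g : Fin (M + 1) → ℝ) (j : Fin (M + 1)) (ω : Ω) :
    Fin n → ℝ :=
  ∑ i with i ≠ j, g i • S.X i ω

theorem measurable_interference (g : Fin (M + 1) → ℝ) (j : Fin (M + 1)) :
    Measurable (S.interference g j) :=
  Finset.measurable_sum _ fun i _ => (S.measurable_X i).const_smul (g i)

theorem Y₂_eq (g : Fin (M + 1) → ℝ) (j : Fin (M + 1)) :
    S.Y₂ g = (fun ω => g j • S.X j ω) + (S.interference g j + S.N₂) := by
  funext ω t
  simp only [Y₂, interference, Pi.add_apply, Pi.smul_apply, Finset.sum_apply, smul_eq_mul]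
  rw [← add_assoc]
  congr 1
  rw [← Finset.add_sum_erase _ _ (Finset.mem_univ j), Finset.filter_ne']

theorem measurable_Xt (i : Fin (M + 1)) : Measurable (S.Xt i) :=
  (S.measurable_X i).add (S.measurable_Nt i)

theorem measurable_Y₁ (h : Fin (M + 1) → ℝ) : Measurable (S.Y₁ h) := by
  have hmX := S.measurable_X
  have hmN := S.measurable_N₁
  unfold Y₁
  fun_prop

theorem measurable_Y₂ (g : Fin (M + 1) → ℝ) : Measurable (S.Y₂ g) := by
  rw [S.Y₂_eq g 0]
  exact ((S.measurable_X 0).const_smul (g 0)).add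
    ((S.measurable_interference g 0).add S.measurable_N₂)

theorem memLp_X {P : ℝ} (hP : S.PowerConstraint P) (i : Fin (M + 1)) (t : Fin n) :
    MemLp (fun ω => S.X i ω t) 2 μ :=
  (memLp_two_iff_integrable_sq ((measurable_pi_apply t).comp
    (S.measurable_X i)).aestronglyMeasurable).2 ((hP i).1 t)

variable [IsProbabilityMeasure μ]

theorem map_Y₂ (g : Fin (M + 1) → ℝ) (j : Fin (M + 1)) :
    μ.map (S.Y₂ g) = μ.map (fun ω => g j • S.X j ω) ∗
      (μ.map (S.interference g j) ∗ Measure.pi fun _ => gaussianReal 0 1) := by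
  have hi : Measurable[S.blockSigma (inputBlock '' {i | i ≠ j})] (S.interference g j) := by
    refine Finset.measurable_sum _ fun i hi => Measurable.const_smul
      (S.measurable_blockSigma_X i (Set.mem_image_of_mem _ ?_)) (g i)
    simpa using hi
  have hd : Disjoint (inputBlock '' {i | i ≠ j})
      ({.noiseEavesdropper} : Set (WiretapBlock M)) := by
    rw [Set.disjoint_singleton_right]
    rintro ⟨i, -, hi⟩
    exact inputBlock_ne_noiseEavesdropper i hi
  have h1 : IndepFun (S.interference g j) S.N₂ μ :=
    S.indepFun_of_disjoint hd hi (S.measurable_blockSigma_N₂ rfl)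
  have h2 : IndepFun (fun ω => g j • S.X j ω) (S.interference g j + S.N₂) μ := by
    refine S.indepFun_of_disjoint (A := {inputBlock j})
      (B := inputBlock '' {i | i ≠ j} ∪ {.noiseEavesdropper}) ?_
      ((S.measurable_blockSigma_X j (Set.mem_singleton _)).const_smul (g j)) (Measurable.add ?_ ?_)
    · rw [Set.disjoint_singleton_left]
      rintro (⟨i, hi, h⟩ | h)
      · exact hi (inputBlock_injective h)
      · exact inputBlock_ne_noiseEavesdropper j h
    · exact hi.mono (biSup_mono fun _ => .inl) le_rfl
    · exact S.measurable_blockSigma_N₂ (.inr rfl)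
  have hmX : Measurable fun ω => g j • S.X j ω := (S.measurable_X j).const_smul (g j)
  rw [S.Y₂_eq g j, h2.map_add_eq_map_conv_map hmX
    ((S.measurable_interference g j).add S.measurable_N₂),
    h1.map_add_eq_map_conv_map (S.measurable_interference g j) S.measurable_N₂, S.law_N₂]

theorem map_Xt (i : Fin (M + 1)) :
    μ.map (S.Xt i) = μ.map (S.X i) ∗ Measure.pi fun _ => gaussianReal 0 (v i) := by
  rw [← S.law_Nt i]
  exact (S.indepFun_X_Nt i).map_add_eq_map_conv_map (S.measurable_X i) (S.measurable_Nt i)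

theorem hasFiniteDiffEntropy_Xt {P : ℝ} (hP : S.PowerConstraint P) (hv : ∀ i, 0 < v i)
    (i : Fin (M + 1)) : HasFiniteDiffEntropy (μ.map (S.Xt i)) := by
  have := Measure.isProbabilityMeasure_map (μ := μ) (S.measurable_X i).aemeasurable
  rw [S.map_Xt]
  refine hasFiniteDiffEntropy_conv_gaussian _ (fun t => ?_) (hv i).ne'
  have hm : Measurable fun u : Fin n → ℝ => u t ^ 2 := (measurable_pi_apply t).pow_const 2
  exact (integrable_map_measure hm.aestronglyMeasurable (S.measurable_X i).aemeasurable).2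
    ((hP i).1 t)

theorem hasFiniteDiffEntropy_Y₂ {P : ℝ} (hP : S.PowerConstraint P) (g : Fin (M + 1) → ℝ) :
    HasFiniteDiffEntropy (μ.map (S.Y₂ g)) := by
  have hmX : Measurable fun ω => g 0 • S.X 0 ω := (S.measurable_X 0).const_smul (g 0)
  have hmI := S.measurable_interference g 0
  have := Measure.isProbabilityMeasure_map (μ := μ) hmX.aemeasurable
  have := Measure.isProbabilityMeasure_map (μ := μ) hmI.aemeasurable
  have hsq : ∀ {f : Ω → Fin n → ℝ}, Measurable f → (∀ t, MemLp (fun ω => f ω t) 2 μ) →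
      ∀ t, MemLp (fun u : Fin n → ℝ => u t) 2 (μ.map f) := fun hf h t =>
    (memLp_map_measure_iff (measurable_pi_apply t).aestronglyMeasurable hf.aemeasurable).2 (h t)
  have h1 : ∀ t, MemLp (fun u : Fin n → ℝ => u t) 2 (μ.map fun ω => g 0 • S.X 0 ω) :=
    hsq hmX fun t => (S.memLp_X hP 0 t).const_mul (g 0)
  have h2 : ∀ t, MemLp (fun u : Fin n → ℝ => u t) 2 (μ.map (S.interference g 0)) :=
    hsq hmI fun t => by
      simp only [interference, Finset.sum_apply, Pi.smul_apply]
      exact memLp_finsetSum _ fun i _ => (S.memLp_X hP i t).const_mul (g i)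
  rw [S.map_Y₂ g 0, ← Measure.conv_assoc]
  refine hasFiniteDiffEntropy_conv_gaussian _ (fun t => ?_) one_ne_zero
  have hm : Measurable fun u : Fin n → ℝ => u t ^ 2 := (measurable_pi_apply t).pow_const 2
  rw [Measure.conv, integrable_map_measure hm.aestronglyMeasurable (by fun_prop)]
  exact ((h1 t).comp_fst _ |>.add ((h2 t).comp_snd _)).integrable_sq

/-- The eavesdropper's output dominates each perturbed input in differential entropy: in law it is
`gⱼ X̃ⱼ` plus an independent vector, because `gⱼ² vⱼ < 1`. -/
theorem diffEntropy_Xt_le {g : Fin (M + 1) → ℝ} {j : Fin (M + 1)} (hg : g j ≠ 0)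
    (hvj : (v j : ℝ) < 1 / g j ^ 2) (hX : HasFiniteDiffEntropy (μ.map (S.Xt j)))
    (hY : HasFiniteDiffEntropy (μ.map (S.Y₂ g))) :
    diffEntropy (μ.map (S.Xt j)) + n * Real.log |g j| ≤ diffEntropy (μ.map (S.Y₂ g)) := by
  have hmI := S.measurable_interference g j
  have := Measure.isProbabilityMeasure_map (μ := μ) (S.measurable_X j).aemeasurable
  have := Measure.isProbabilityMeasure_map (μ := μ) (S.measurable_Xt j).aemeasurable
  have := Measure.isProbabilityMeasure_map (μ := μ) hmI.aemeasurable
  have hmX : Measurable fun ω => g j • S.X j ω := (S.measurable_X j).const_smul (g j)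
  have := Measure.isProbabilityMeasure_map (μ := μ) hmX.aemeasurable
  -- the channel noise splits into the scaled perturbation and an independent remainder
  set a : ℝ≥0 := ⟨g j ^ 2, sq_nonneg _⟩ * v j with ha
  have ha1 : a ≤ 1 := by
    rw [← NNReal.coe_le_coe, ha]
    rw [lt_div_iff₀ (by positivity)] at hvj
    push_cast
    change g j ^ 2 * (v j : ℝ) ≤ 1
    linarith
  have hnoise : (Measure.pi fun _ : Fin n => gaussianReal 0 1) =
      (Measure.pi fun _ : Fin n => gaussianReal 0 a) ∗
        Measure.pi fun _ : Fin n => gaussianReal 0 (1 - a) := by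
    rw [pi_conv_pi, gaussianReal_conv_gaussianReal, add_zero, add_tsub_cancel_of_le ha1]
  have hscale : (Measure.pi fun _ : Fin n => gaussianReal 0 (v j)).map (fun x => g j • x) =
      Measure.pi fun _ : Fin n => gaussianReal 0 a := by
    have := Measure.pi_map_pi (μ := fun _ : Fin n => gaussianReal 0 (v j))
      (f := fun _ x => g j * x) fun _ => by fun_prop
    simp only [gaussianReal_map_const_mul, mul_zero] at this
    exact this
  refine diffEntropy_add_log_le
    (ρ := μ.map (S.interference g j) ∗ Measure.pi fun _ => gaussianReal 0 (1 - a)) hg ?_ hX hY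
  have hL := Measure.map_conv_continuousLinearMap (μ := μ.map (S.X j))
    (ν := Measure.pi fun _ : Fin n => gaussianReal 0 (v j))
    (g j • ContinuousLinearMap.id ℝ (Fin n → ℝ))
  have hLf : ⇑(g j • ContinuousLinearMap.id ℝ (Fin n → ℝ)) = fun x => g j • x := rfl
  rw [hLf, hscale, Measure.map_map (measurable_const_smul _) (S.measurable_X j),
    ← S.map_Xt] at hL
  have hprod : ∀ (α β : Measure (Fin n → ℝ)) [IsProbabilityMeasure α] [IsProbabilityMeasure β],
      (α.prod β).map (fun p => g j • p.1 + p.2) = (α.map fun x => g j • x) ∗ β := by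
    intro α β _ _
    have := Measure.map_prod_map α β (measurable_const_smul (g j) : Measurable fun x => g j • x)
      measurable_id
    rw [Measure.map_id] at this
    rw [Measure.conv, this, Measure.map_map (by fun_prop) (by fun_prop)]
    rfl
  rw [hprod, hL, S.map_Y₂ g j, hnoise]
  change μ.map (fun ω => g j • S.X j ω) ∗ _ = (μ.map (fun ω => g j • S.X j ω) ∗ _) ∗ _
  rw [Measure.conv_assoc, ← Measure.conv_assoc (μ.map (S.interference g j)),
    Measure.conv_comm (μ.map (S.interference g j)), Measure.conv_assoc]

end WiretapScheme

/-! ### Log-likelihood cost of the guess -/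

/-- Log-likelihood cost of the guess `d` when the message is `w`. The sub-probability
`exp (-guessCost d ·)` gives mass `1 / 2` to `d` and `1 / (2 |𝓦|)` to every other message, so that
an error costs `log |𝓦|`. -/
noncomputable def guessCost {𝓦 : Type*} [Fintype 𝓦] (d w : 𝓦) : ℝ :=
  Real.log 2 + ({w | w ≠ d} : Set 𝓦).indicator (fun _ => Real.log (Fintype.card 𝓦)) w

theorem sum_exp_neg_guessCost_le {𝓦 : Type*} [Fintype 𝓦] (d : 𝓦) :
    ∑ w, ENNReal.ofReal (Real.exp (-guessCost d w)) ≤ 1 := by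
  classical
  have hN : (0 : ℝ) < Fintype.card 𝓦 := by exact_mod_cast Fintype.card_pos_iff.2 ⟨d⟩
  rw [← ENNReal.ofReal_sum_of_nonneg fun _ _ => (Real.exp_pos _).le, ENNReal.ofReal_le_one,
    ← Finset.add_sum_erase _ _ (Finset.mem_univ d)]
  have h1 : Real.exp (-guessCost d d) = 1 / 2 := by
    rw [guessCost, Set.indicator_of_notMem (by simp), add_zero, Real.exp_neg,
      Real.exp_log two_pos, one_div]
  have h2 : ∀ w ∈ Finset.univ.erase d,
      Real.exp (-guessCost d w) = 1 / (2 * Fintype.card 𝓦) := fun w hw => by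
    rw [guessCost, Set.indicator_of_mem (by simpa using hw), Real.exp_neg, Real.exp_add,
      Real.exp_log two_pos, Real.exp_log hN, one_div]
  rw [h1, Finset.sum_congr rfl h2, Finset.sum_const, Finset.card_erase_of_mem (Finset.mem_univ d),
    Finset.card_univ, nsmul_eq_mul]
  have h3 : ((Fintype.card 𝓦 - 1 : ℕ) : ℝ) ≤ Fintype.card 𝓦 := by
    exact_mod_cast Nat.sub_le _ _
  have h4 : ((Fintype.card 𝓦 - 1 : ℕ) : ℝ) * (1 / (2 * Fintype.card 𝓦)) ≤ 1 / 2 := by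
    rw [mul_one_div, div_le_div_iff₀ (by positivity) two_pos]
    linarith
  linarith

/-! ### Laws and expected costs of the noises of a scheme -/

namespace WiretapScheme

variable {Ω : Type*} [MeasurableSpace Ω] {μ : Measure Ω}
  {𝓦 : Type*} [Fintype 𝓦] [MeasurableSpace 𝓦] {M n : ℕ} {v : Fin (M + 1) → ℝ≥0}
  (S : WiretapScheme μ 𝓦 M n v)

theorem integrable_integral_sq_noise {v : ℝ≥0} {N : Ω → Fin n → ℝ} (hN : Measurable N)
    (hlaw : μ.map N = Measure.pi fun _ => gaussianReal 0 v) (t : Fin n) :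
    Integrable (fun ω => N ω t ^ 2) μ ∧ ∫ ω, N ω t ^ 2 ∂μ = v := by
  have hm : Measurable fun u : Fin n → ℝ => u t ^ 2 := (measurable_pi_apply t).pow_const 2
  constructor
  · have := integrable_sq_pi_gaussianReal v t
    rw [← hlaw] at this
    exact (integrable_map_measure hm.aestronglyMeasurable hN.aemeasurable).1 this
  · rw [← integral_sq_pi_gaussianReal v t, ← hlaw,
      integral_map hN.aemeasurable hm.aestronglyMeasurable]

variable [IsProbabilityMeasure μ]

/-- The joint law of the noise at the legitimate receiver and of the perturbations. -/
theorem map_noise (hv : ∀ i, 0 < v i) :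
    μ.map (fun ω => (S.N₁ ω, fun i => S.Nt i ω)) =
      (volume : Measure ((Fin n → ℝ) × (Fin (M + 1) → Fin n → ℝ))).withDensity
        (fun e => gaussianVecPDF n 1 e.1 * ∏ i, gaussianVecPDF n (v i) (e.2 i)) := by
  have hNt : Measurable fun ω => fun i => S.Nt i ω := measurable_pi_lambda _ S.measurable_Nt
  have hi : IndepFun S.N₁ (fun ω => fun i => S.Nt i ω) μ := by
    refine S.indepFun_of_disjoint (A := {.noiseReceiver}) (B := Set.range .perturbation) ?_
      (S.measurable_blockSigma_N₁ rfl) ?_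
    · rw [Set.disjoint_singleton_left]
      rintro ⟨i, hi⟩
      cases hi
    · exact @measurable_pi_lambda _ _ _ (S.blockSigma _) _ _
        fun i => S.measurable_blockSigma_Nt i ⟨i, rfl⟩
  have hii : iIndepFun S.Nt μ := by
    rw [iIndepFun_iff_iIndep]
    exact S.indep.precomp (g := WiretapBlock.perturbation) fun i j h => by cases h; rfl
  have hg := fun i => pi_gaussianReal_eq_withDensity n (hv i).ne'
  have hsf : ∀ i, SigmaFinite ((volume : Measure (Fin n → ℝ)).withDensity
      (gaussianVecPDF n (v i))) := fun i => by rw [← hg]; infer_instance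
  rw [(indepFun_iff_map_prod_eq_prod_map_map S.measurable_N₁.aemeasurable hNt.aemeasurable).1 hi,
    hii.map_fun_eq_pi_map fun i => (S.measurable_Nt i).aemeasurable, S.law_N₁]
  simp only [S.law_Nt, hg]
  rw [pi_gaussianReal_eq_withDensity n one_ne_zero,
    pi_withDensity _ fun i => measurable_gaussianVecPDF n (v i),
    prod_withDensity (by fun_prop) (by fun_prop)]
  rfl

theorem integrable_integral_letterCost (h g : Fin (M + 1) → ℝ) (t : Fin n) :
    Integrable (fun ω => letterCost h g v (S.N₁ ω t) (S.N₂ ω t) fun i => S.Nt i ω t) μ ∧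
    ∫ ω, letterCost h g v (S.N₁ ω t) (S.N₂ ω t) (fun i => S.Nt i ω t) ∂μ =
      meanLetterCost h g v := by
  obtain ⟨i1, e1⟩ := integrable_integral_sq_noise S.measurable_N₁ S.law_N₁ t
  obtain ⟨i2, e2⟩ := integrable_integral_sq_noise S.measurable_N₂ S.law_N₂ t
  have i3 := fun i => (integrable_integral_sq_noise (S.measurable_Nt i) (S.law_Nt i) t).1
  have e3 := fun i => (integrable_integral_sq_noise (S.measurable_Nt i) (S.law_Nt i) t).2
  have i4 : Integrable (fun ω => (∑ i, h i ^ 2 + ∑ i, g i ^ 2) * ∑ i, S.Nt i ω t ^ 2) μ :=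
    (integrable_finsetSum _ fun i _ => i3 i).const_mul _
  have i12 : Integrable (fun ω => S.N₁ ω t ^ 2 + S.N₂ ω t ^ 2) μ := i1.add i2
  have i5 : Integrable (fun ω => S.N₁ ω t ^ 2 + S.N₂ ω t ^ 2 +
    (∑ i, h i ^ 2 + ∑ i, g i ^ 2) * ∑ i, S.Nt i ω t ^ 2) μ := i12.add i4
  refine ⟨(integrable_const _).add i5, ?_⟩
  simp only [letterCost]
  rw [integral_add (integrable_const _) i5, integral_add i12 i4, integral_add i1 i2,
    integral_const_mul, integral_finsetSum _ fun i _ => i3 i, e1, e2]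
  simp [e3, meanLetterCost]

variable [MeasurableSingletonClass 𝓦]

theorem integrable_integral_guessCost (h : Fin (M + 1) → ℝ) :
    Integrable (fun ω => guessCost (S.decoder (S.Y₁ h ω)) (S.W ω)) μ ∧
    ∫ ω, guessCost (S.decoder (S.Y₁ h ω)) (S.W ω) ∂μ =
      Real.log 2 + μ.real {ω | S.W ω ≠ S.decoder (S.Y₁ h ω)} * Real.log (Fintype.card 𝓦) := by
  have hms : MeasurableSet {ω | S.W ω ≠ S.decoder (S.Y₁ h ω)} :=
    (measurableSet_eq_fun S.measurable_W (S.measurable_decoder.comp (S.measurable_Y₁ h))).compl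
  have heq : (fun ω => guessCost (S.decoder (S.Y₁ h ω)) (S.W ω)) = fun ω => Real.log 2 +
      {ω | S.W ω ≠ S.decoder (S.Y₁ h ω)}.indicator (fun _ => Real.log (Fintype.card 𝓦)) ω := rfl
  have hi : Integrable ({ω | S.W ω ≠ S.decoder (S.Y₁ h ω)}.indicator
      fun _ => Real.log (Fintype.card 𝓦)) μ := (integrable_const _).indicator hms
  rw [heq]
  refine ⟨(integrable_const _).add hi, ?_⟩
  rw [integral_add (integrable_const _) hi, integral_indicator_const _ hms]
  simp

end WiretapScheme

/-! ### The simulated system -/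

section SimulationKernel

variable {𝓦 : Type*} [Fintype 𝓦] {M n : ℕ}

/-- Joint density of a simulated system: inputs with densities `f i`, received through standard
Gaussian noise at both receivers (`x.1` at the eavesdropper, `e.1` at the legitimate receiver),
and the message `x.2` guessed from `e.1`. The inputs are `e.2`. The total mass may be less than
one, because the guess is a sub-probability. -/
noncomputable def simulationDensity (h g : Fin (M + 1) → ℝ) (dec : (Fin n → ℝ) → 𝓦)
    (f : Fin (M + 1) → (Fin n → ℝ) → ℝ≥0∞)
    (x : (Fin n → ℝ) × 𝓦) (e : (Fin n → ℝ) × (Fin (M + 1) → Fin n → ℝ)) : ℝ≥0∞ :=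
  (∏ i, f i (e.2 i)) * (gaussianVecPDF n 1 (fun t => x.1 t - ∑ i, g i * e.2 i t) *
    gaussianVecPDF n 1 (fun t => e.1 t - ∑ i, h i * e.2 i t)) *
      ENNReal.ofReal (Real.exp (-guessCost (dec e.1) x.2))

variable [MeasurableSpace 𝓦] [MeasurableSingletonClass 𝓦]
  (h g : Fin (M + 1) → ℝ) {dec : (Fin n → ℝ) → 𝓦}
  {f : Fin (M + 1) → (Fin n → ℝ) → ℝ≥0∞}

theorem measurable_simulationDensity (hdec : Measurable dec) (hf : ∀ i, Measurable (f i)) :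
    Measurable (Function.uncurry (simulationDensity h g dec f)) := by
  have hc : Measurable fun p : 𝓦 × 𝓦 => ENNReal.ofReal (Real.exp (-guessCost p.1 p.2)) :=
    measurable_of_countable _
  have hm : ∀ (k : Fin (M + 1) → ℝ)
      {u : ((Fin n → ℝ) × 𝓦) × ((Fin n → ℝ) × (Fin (M + 1) → Fin n → ℝ)) → Fin n → ℝ},
      Measurable u → Measurable fun p :
        ((Fin n → ℝ) × 𝓦) × ((Fin n → ℝ) × (Fin (M + 1) → Fin n → ℝ)) =>
        gaussianVecPDF n 1 (fun t => u p t - ∑ i, k i * p.2.2 i t) := fun k u hu => by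
    refine (measurable_gaussianVecPDF n 1).comp (measurable_pi_lambda _ fun t => ?_)
    fun_prop
  unfold simulationDensity Function.uncurry
  refine ((Finset.measurable_prod _ fun i _ => (hf i).comp (by fun_prop)).mul
    ((hm g (by fun_prop)).mul (hm h (by fun_prop)))).mul
    (hc.comp ((hdec.comp (by fun_prop)).prodMk (by fun_prop)))

theorem lintegral_simulationDensity_le_one (hdec : Measurable dec) (hf : ∀ i, Measurable (f i))
    (hf1 : ∀ i, ∫⁻ x, f i x = 1) :
    ∫⁻ x, ∫⁻ e, simulationDensity h g dec f x e ∂volume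
      ∂((volume : Measure (Fin n → ℝ)).prod Measure.count) ≤ 1 := by
  have hγ : ∀ c : Fin n → ℝ, ∫⁻ y : Fin n → ℝ, gaussianVecPDF n 1 (fun t => y t - c t) = 1 :=
    fun c => by
      rw [← lintegral_gaussianVecPDF n one_ne_zero]
      exact lintegral_sub_right_eq_self (gaussianVecPDF n 1) c
  have hγm : ∀ c : Fin n → ℝ, Measurable fun y : Fin n → ℝ =>
      gaussianVecPDF n 1 (fun t => y t - c t) := fun c =>
    (measurable_gaussianVecPDF n 1).comp (measurable_id.sub_const c)
  have hKm := measurable_simulationDensity h g hdec hf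
  rw [lintegral_lintegral_swap hKm.aemeasurable]
  -- integrating out the eavesdropper's output and the message
  have h1 : ∀ e : (Fin n → ℝ) × (Fin (M + 1) → Fin n → ℝ),
      ∫⁻ x, simulationDensity h g dec f x e
        ∂((volume : Measure (Fin n → ℝ)).prod Measure.count) ≤
      (∏ i, f i (e.2 i)) * gaussianVecPDF n 1 (fun t => e.1 t - ∑ i, h i * e.2 i t) := fun e => by
    have hw : Measurable fun w : 𝓦 => ENNReal.ofReal (Real.exp (-guessCost (dec e.1) w)) :=
      measurable_of_countable _
    have hy := hγm fun t => ∑ i, g i * e.2 i t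
    calc ∫⁻ x, simulationDensity h g dec f x e
          ∂((volume : Measure (Fin n → ℝ)).prod Measure.count)
        = ∫⁻ x, ((∏ i, f i (e.2 i)) * gaussianVecPDF n 1 (fun t => e.1 t - ∑ i, h i * e.2 i t)) *
            (gaussianVecPDF n 1 (fun t => x.1 t - ∑ i, g i * e.2 i t) *
              ENNReal.ofReal (Real.exp (-guessCost (dec e.1) x.2)))
            ∂((volume : Measure (Fin n → ℝ)).prod Measure.count) := by
          refine lintegral_congr fun x => ?_
          unfold simulationDensity
          ring
      _ = ((∏ i, f i (e.2 i)) * gaussianVecPDF n 1 (fun t => e.1 t - ∑ i, h i * e.2 i t)) *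
            (1 * ∑ w, ENNReal.ofReal (Real.exp (-guessCost (dec e.1) w))) := by
          have hyw : Measurable fun x : (Fin n → ℝ) × 𝓦 =>
              gaussianVecPDF n 1 (fun t => x.1 t - ∑ i, g i * e.2 i t) *
                ENNReal.ofReal (Real.exp (-guessCost (dec e.1) x.2)) :=
            (hy.comp measurable_fst).mul (hw.comp measurable_snd)
          rw [lintegral_const_mul _ hyw,
            lintegral_prod_mul hy.aemeasurable hw.aemeasurable, hγ, lintegral_fintype]
          simp
      _ ≤ _ := by
          rw [one_mul]
          exact mul_le_of_le_one_right' (sum_exp_neg_guessCost_le _)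
  have hm2 : Measurable fun e : (Fin n → ℝ) × (Fin (M + 1) → Fin n → ℝ) =>
      (∏ i, f i (e.2 i)) * gaussianVecPDF n 1 (fun t => e.1 t - ∑ i, h i * e.2 i t) :=
    (Finset.measurable_prod _ fun i _ => (hf i).comp (by fun_prop)).mul
      ((measurable_gaussianVecPDF n 1).comp (measurable_pi_lambda _ fun t => by fun_prop))
  refine (lintegral_mono h1).trans ?_
  rw [Measure.volume_eq_prod, lintegral_prod_symm _ hm2.aemeasurable]
  have h2 : ∀ z : Fin (M + 1) → Fin n → ℝ,
      ∫⁻ y : Fin n → ℝ, (∏ i, f i (z i)) * gaussianVecPDF n 1 (fun t => y t - ∑ i, h i * z i t) =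
        ∏ i, f i (z i) := fun z => by
    rw [lintegral_const_mul _ (hγm fun t => ∑ i, h i * z i t), hγ, mul_one]
  simp only [h2]
  rw [volume_pi, lintegral_fin_prod_eq_prod f hf]
  simp [hf1]

end SimulationKernel

/-! ### The entropy of the message and the eavesdropper's output -/

namespace WiretapScheme

variable {Ω : Type*} [MeasurableSpace Ω] {μ : Measure Ω} [IsProbabilityMeasure μ]
  {𝓦 : Type*} [Fintype 𝓦] [Nonempty 𝓦] [MeasurableSpace 𝓦] [MeasurableSingletonClass 𝓦]
  {M n : ℕ} {v : Fin (M + 1) → ℝ≥0}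
  (S : WiretapScheme μ 𝓦 M n v)

/-- `H(W, Y₂) ≤ ∑ h(X̃ᵢ)` up to the error probability and a constant per channel use. -/
theorem condShannonEntropy_add_diffEntropy_le (h g : Fin (M + 1) → ℝ) (hv : ∀ i, 0 < v i)
    (hX : ∀ i, HasFiniteDiffEntropy (μ.map (S.Xt i)))
    (hY : HasFiniteDiffEntropy (μ.map (S.Y₂ g))) :
    condShannonEntropy μ S.W (S.Y₂ g) + diffEntropy (μ.map (S.Y₂ g)) ≤
      ∑ i, diffEntropy (μ.map (S.Xt i)) + n * meanLetterCost h g v +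
        (Real.log 2 +
          μ.real {ω | S.W ω ≠ S.decoder (S.Y₁ h ω)} * Real.log (Fintype.card 𝓦)) := by
  have hmY := S.measurable_Y₂ g
  have pX : ∀ i, MeasurePreserving (S.Xt i) μ (μ.map (S.Xt i)) :=
    fun i => (S.measurable_Xt i).measurePreserving μ
  have pY : MeasurePreserving (S.Y₂ g) μ (μ.map (S.Y₂ g)) := hmY.measurePreserving μ
  set fX : Fin (M + 1) → (Fin n → ℝ) → ℝ≥0∞ := fun i => (μ.map (S.Xt i)).rnDeriv volume
  set fY : (Fin n → ℝ) → ℝ≥0∞ := (μ.map (S.Y₂ g)).rnDeriv volume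
  set post : (Fin n → ℝ) → 𝓦 → ℝ≥0∞ :=
    fun y w => condDistrib S.W (S.Y₂ g) μ y {w}
  have hfXm : ∀ i, Measurable (fX i) := fun i => Measure.measurable_rnDeriv _ _
  have hfX1 : ∀ i, ∫⁻ x, fX i x = 1 := fun i => by
    have := Measure.isProbabilityMeasure_map (μ := μ) (S.measurable_Xt i).aemeasurable
    exact lintegral_rnDeriv_eq_one (hX i).1
  obtain ⟨iπ, eπ⟩ := integrable_integral_log_condDistrib (μ := μ) S.measurable_W hmY
  obtain ⟨iG, eG⟩ := S.integrable_integral_guessCost h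
  have iX : Integrable (fun ω => ∑ i, Real.log (fX i (S.Xt i ω)).toReal) μ :=
    integrable_finsetSum _ fun i _ => (hX i).integrable_log (pX i)
  have iC : Integrable (fun ω => ∑ t, letterCost h g v (S.N₁ ω t) (S.N₂ ω t)
      fun i => S.Nt i ω t) μ :=
    integrable_finsetSum _ fun t _ => (S.integrable_integral_letterCost h g t).1
  have iY := hY.integrable_log pY
  -- `exp L` is a lower bound for the ratio of the simulated density to the true one
  have key := integral_nonpos_of_lintegral_exp_le_one (μ := μ) (L := fun ω =>
      ∑ i, Real.log (fX i (S.Xt i ω)).toReal -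
        ∑ t, letterCost h g v (S.N₁ ω t) (S.N₂ ω t) (fun i => S.Nt i ω t) -
        guessCost (S.decoder (S.Y₁ h ω)) (S.W ω) -
        Real.log (fY (S.Y₂ g ω)).toReal - Real.log (post (S.Y₂ g ω) (S.W ω)).toReal)
      ((((iX.sub iC).sub iG).sub iY).sub iπ) ?_
  · have e1 := integral_sub (((iX.sub iC).sub iG).sub iY) iπ
    have e2 := integral_sub ((iX.sub iC).sub iG) iY
    have e3 := integral_sub (iX.sub iC) iG
    have e4 := integral_sub iX iC
    simp only [Pi.sub_apply] at e1 e2 e3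
    rw [e1, e2, e3, e4, eπ, eG, hY.integral_log pY,
      integral_finsetSum _ fun i _ => (hX i).integrable_log (pX i),
      integral_finsetSum _ fun t _ => (S.integrable_integral_letterCost h g t).1] at key
    simp only [fun i => (hX i).integral_log (pX i),
      fun t => (S.integrable_integral_letterCost h g t).2, Finset.sum_neg_distrib,
      Finset.sum_const, Finset.card_univ, Fintype.card_fin, nsmul_eq_mul] at key
    linarith
  set φ : (Fin n → ℝ) × (Fin (M + 1) → Fin n → ℝ) → ℝ≥0∞ :=
    fun e => gaussianVecPDF n 1 e.1 * ∏ i, gaussianVecPDF n (v i) (e.2 i)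
  have hφm : Measurable φ := by fun_prop
  set fYW : (Fin n → ℝ) × 𝓦 → ℝ≥0∞ := fun x => fY x.1 * post x.1 x.2
  have hfYWm : Measurable fYW :=
    ((Measure.measurable_rnDeriv _ _).comp measurable_fst).mul measurable_condDistrib_singleton
  have hjoint := map_prod_eq_withDensity (μ := μ) (Y := S.Y₂ g) S.measurable_W hY.1
  -- the pair `(Y₂, W)` and the noiseless part of `(Y₁, X̃)` as functions of `((W, X), N₂)`
  have hmτ : Measurable fun ω => ((S.W ω, fun i => S.X i ω), S.N₂ ω) :=
    (S.measurable_W.prodMk (measurable_pi_lambda _ S.measurable_X)).prodMk S.measurable_N₂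
  have hms : Measurable fun τ : (𝓦 × (Fin (M + 1) → Fin n → ℝ)) × (Fin n → ℝ) =>
      ((fun t => ∑ i, h i * τ.1.2 i t : Fin n → ℝ), τ.1.2) := by fun_prop
  have hmV : Measurable fun τ : (𝓦 × (Fin (M + 1) → Fin n → ℝ)) × (Fin n → ℝ) =>
      ((fun t => (∑ i, g i * τ.1.2 i t) + τ.2 t : Fin n → ℝ), τ.1.1) := by fun_prop
  have : (volume : Measure (Fin n → ℝ)).IsAddLeftInvariant := inferInstance
  have : (volume : Measure (Fin (M + 1) → Fin n → ℝ)).IsAddLeftInvariant :=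
    inferInstanceAs (Measure.pi fun _ => (volume : Measure (Fin n → ℝ))).IsAddLeftInvariant
  have : (volume : Measure ((Fin n → ℝ) × (Fin (M + 1) → Fin n → ℝ))).IsAddLeftInvariant :=
    inferInstanceAs (((volume : Measure (Fin n → ℝ)).prod
      (volume : Measure (Fin (M + 1) → Fin n → ℝ))).IsAddLeftInvariant)
  have hle := lintegral_density_ratio_le_one hmτ
    (S.measurable_N₁.prodMk (measurable_pi_lambda _ S.measurable_Nt)) hms hmV
    S.indepFun_code_noise hφm (S.map_noise hv) hfYWm hjoint
    (measurable_simulationDensity h g S.measurable_decoder hfXm)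
    (lintegral_simulationDensity_le_one h g S.measurable_decoder hfXm hfX1)
  refine le_trans (lintegral_mono_ae ?_) hle
  -- the logarithms are genuine almost surely, as no true density vanishes at its own sample
  have hpos : ∀ᵐ ω ∂μ, fYW (S.Y₂ g ω, S.W ω) ≠ 0 := by
    refine ae_of_ae_map (hmY.prodMk S.measurable_W).aemeasurable (p := fun x => fYW x ≠ 0) ?_
    rw [hjoint, ae_withDensity_iff hfYWm]
    exact .of_forall fun x hx => hx
  filter_upwards [hpos, hY.ae_rnDeriv pY, ae_all_iff.2 fun i => (hX i).ae_rnDeriv (pX i)]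
    with ω hω hωY hωX
  have hpost0 : post (S.Y₂ g ω) (S.W ω) ≠ 0 := right_ne_zero_of_mul hω
  have hpostt : post (S.Y₂ g ω) (S.W ω) ≠ ∞ := measure_ne_top _ _
  have hφ0 : φ (S.N₁ ω, fun i => S.Nt i ω) ≠ 0 := mul_ne_zero
    (gaussianVecPDF_ne_zero one_ne_zero _)
    (Finset.prod_ne_zero_iff.2 fun i _ => gaussianVecPDF_ne_zero (hv i).ne' _)
  have hφt : φ (S.N₁ ω, fun i => S.Nt i ω) ≠ ∞ := ENNReal.mul_ne_top (gaussianVecPDF_ne_top _)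
    (ENNReal.prod_ne_top fun i _ => gaussianVecPDF_ne_top _)
  have hb := ofReal_exp_neg_sum_letterCost_mul_le h g v hv (S.N₁ ω) (S.N₂ ω) fun i => S.Nt i ω
  rw [← ENNReal.le_div_iff_mul_le (.inl hφ0) (.inl hφt), div_eq_mul_inv] at hb
  have hexp : ENNReal.ofReal (Real.exp (∑ i, Real.log (fX i (S.Xt i ω)).toReal)) =
      ∏ i, fX i (S.Xt i ω) := by
    rw [Real.exp_sum, ENNReal.ofReal_prod_of_nonneg fun _ _ => (Real.exp_pos _).le]
    exact Finset.prod_congr rfl fun i _ => ENNReal.ofReal_exp_log_toReal (hωX i).1 (hωX i).2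
  have hr2 : (fun t => S.Y₂ g ω t - ∑ i, g i * S.Xt i ω t) =
      fun t => S.N₂ ω t - ∑ i, g i * S.Nt i ω t := by
    funext t
    simp only [Y₂, Xt, mul_add, Finset.sum_add_distrib]
    ring
  have hr1 : (fun t => S.Y₁ h ω t - ∑ i, h i * S.Xt i ω t) =
      fun t => S.N₁ ω t - ∑ i, h i * S.Nt i ω t := by
    funext t
    simp only [Y₁, Xt, mul_add, Finset.sum_add_distrib]
    ring
  have hinv : (fYW (S.Y₂ g ω, S.W ω))⁻¹ =
      (fY (S.Y₂ g ω))⁻¹ * (post (S.Y₂ g ω) (S.W ω))⁻¹ :=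
    ENNReal.mul_inv (.inl hωY.1) (.inl hωY.2)
  change _ ≤ (∏ i, fX i (S.Xt i ω)) *
    (gaussianVecPDF n 1 (fun t => S.Y₂ g ω t - ∑ i, g i * S.Xt i ω t) *
      gaussianVecPDF n 1 (fun t => S.Y₁ h ω t - ∑ i, h i * S.Xt i ω t)) *
    ENNReal.ofReal (Real.exp (-guessCost (S.decoder (S.Y₁ h ω)) (S.W ω))) *
    ((φ (S.N₁ ω, fun i => S.Nt i ω))⁻¹ * (fYW (S.Y₂ g ω, S.W ω))⁻¹)
  have hmul : ∀ a b : ℝ, ENNReal.ofReal (Real.exp (a - b)) =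
      ENNReal.ofReal (Real.exp a) * ENNReal.ofReal (Real.exp (-b)) := fun a b => by
    rw [sub_eq_add_neg, Real.exp_add, ENNReal.ofReal_mul (Real.exp_pos _).le]
  rw [hr1, hr2, hinv, hmul, hmul, hmul, hmul, hexp,
    ENNReal.ofReal_exp_neg_log_toReal hωY.1 hωY.2,
    ENNReal.ofReal_exp_neg_log_toReal hpost0 hpostt]
  calc _ ≤ (∏ i, fX i (S.Xt i ω)) *
          (gaussianVecPDF n 1 (fun t => S.N₂ ω t - ∑ i, g i * S.Nt i ω t) *
            gaussianVecPDF n 1 (fun t => S.N₁ ω t - ∑ i, h i * S.Nt i ω t) *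
            (φ (S.N₁ ω, fun i => S.Nt i ω))⁻¹) *
          ENNReal.ofReal (Real.exp (-guessCost (S.decoder (S.Y₁ h ω)) (S.W ω))) *
          (fY (S.Y₂ g ω))⁻¹ * (post (S.Y₂ g ω) (S.W ω))⁻¹ := by
        gcongr
    _ = _ := by ring

end WiretapScheme

/-! ### The secrecy penalty -/

theorem shannonEntropy_of_uniform {Ω 𝓦 : Type*} [MeasurableSpace Ω] [Fintype 𝓦] [Nonempty 𝓦]
    {μ : Measure Ω} {W : Ω → 𝓦} (hW : ∀ w, μ.real (W ⁻¹' {w}) = 1 / (Fintype.card 𝓦 : ℝ)) :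
    shannonEntropy μ W = Real.log (Fintype.card 𝓦) := by
  have hN : (Fintype.card 𝓦 : ℝ) ≠ 0 := by exact_mod_cast Fintype.card_ne_zero
  simp only [shannonEntropy, hW, Real.negMulLog, Finset.sum_const, Finset.card_univ, nsmul_eq_mul,
    one_div, Real.log_inv]
  field_simp

theorem lemma1 (M : ℕ) (h g : Fin (M + 1) → ℝ) (hh : ∀ i, h i ≠ 0) (hg : ∀ i, g i ≠ 0)
    (v : Fin (M + 1) → ℝ≥0) (hv_pos : ∀ i, 0 < v i)
    (hv_lt : ∀ i, (v i : ℝ) < min (1 / h i ^ 2) (1 / g i ^ 2)) (κ : ℝ) :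
    ∃ c c' : ℝ,
      ∀ (Ω : Type*) [MeasurableSpace Ω] (μ : Measure Ω) [IsProbabilityMeasure μ]
        (𝓦 : Type*) [Fintype 𝓦] [Nonempty 𝓦] [MeasurableSpace 𝓦] [MeasurableSingletonClass 𝓦]
        (n : ℕ) (_ : 0 < n) (P ε : ℝ) (S : WiretapScheme μ 𝓦 M n v),
        S.PowerConstraint P → S.Reliable h ε → S.Secure g ε → ε * (1 + S.rate) ≤ κ →
          (∀ i, HasFiniteDiffEntropy (μ.map (S.Xt i))) ∧
          HasFiniteDiffEntropy (μ.map (S.Y₂ g)) ∧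
          n * S.rate ≤
            (∑ i, diffEntropy (μ.map (S.Xt i))) - diffEntropy (μ.map (S.Y₂ g)) + n * c ∧
          ∀ j : Fin (M + 1),
            (∑ i, diffEntropy (μ.map (S.Xt i))) - diffEntropy (μ.map (S.Y₂ g)) + n * c ≤
              (∑ i with i ≠ j, diffEntropy (μ.map (S.Xt i))) + n * c' := by
  refine ⟨meanLetterCost h g v + Real.log 2 + κ,
    meanLetterCost h g v + Real.log 2 + κ + ∑ i, |Real.log (|g i|)|, ?_⟩
  intro Ω _ μ _ 𝓦 _ _ _ _ n hn P ε S hP hrel hsec hε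
  have hX := S.hasFiniteDiffEntropy_Xt hP hv_pos
  have hY := S.hasFiniteDiffEntropy_Y₂ hP g
  have hn1 : (1 : ℝ) ≤ n := by exact_mod_cast hn
  have hn0 : (n : ℝ) ≠ 0 := by positivity
  refine ⟨hX, hY, ?_, fun j => ?_⟩
  · have hrate : Real.log (Fintype.card 𝓦) = n * S.rate := by
      rw [WiretapScheme.rate, mul_div_cancel₀ _ hn0]
    have hlog0 : 0 ≤ Real.log (Fintype.card 𝓦) := Real.log_natCast_nonneg _
    have hmain := S.condShannonEntropy_add_diffEntropy_le h g hv_pos hX hY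
    have herr : μ.real {ω | S.W ω ≠ S.decoder (S.Y₁ h ω)} * Real.log (Fintype.card 𝓦) ≤
        ε * Real.log (Fintype.card 𝓦) := mul_le_mul_of_nonneg_right hrel hlog0
    have hs : n * S.rate - n * ε ≤ condShannonEntropy μ S.W (S.Y₂ g) := by
      have h1 := mul_le_mul_of_nonneg_left hsec (Nat.cast_nonneg (α := ℝ) n)
      rw [shannonEntropy_of_uniform S.uniform_W, mul_sub, ← mul_assoc, ← mul_assoc,
        mul_one_div_cancel hn0, one_mul, one_mul, hrate] at h1
      exact h1
    have hlog2 : Real.log 2 ≤ n * Real.log 2 :=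
      le_mul_of_one_le_left (Real.log_nonneg one_le_two) hn1
    have hκ : n * (ε * (1 + S.rate)) ≤ n * κ := mul_le_mul_of_nonneg_left hε (by positivity)
    rw [hrate] at herr hmain
    linarith
  · have h1 := S.diffEntropy_Xt_le (hg j) ((hv_lt j).trans_le (min_le_right _ _)) (hX j) hY
    have h2 : |Real.log (|g j|)| ≤ ∑ i, |Real.log (|g i|)| :=
      Finset.single_le_sum (f := fun i => |Real.log (|g i|)|) (fun _ _ => abs_nonneg _)
        (Finset.mem_univ j)
    have h3 : (n : ℝ) * -Real.log (|g j|) ≤ n * ∑ i, |Real.log (|g i|)| :=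
      mul_le_mul_of_nonneg_left ((neg_le_abs _).trans h2) (by positivity)
    rw [← Finset.add_sum_erase _ _ (Finset.mem_univ j), Finset.filter_ne']
    linarith
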